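/- Let $\Omega\subset\mathbb R^2$ be an open set whose boundary $\partial\Omega$ is nonempty, compact and $C^\infty$: it is the disjoint union of finitely many simple closed curves, each parametrized by arc-length by a smooth periodic map $s\mapsto M(s)$, and $\Omega$ lies locally on one side of $\partial\Omega$, namely on the left of each curve. Let $N(s)$ be the inward unit normal at $M(s)$ and let the curvature $\kappa(s)$ be defined by $M''(s)=\kappa(s)N(s)$ (so $\kappa=1/R$ when $\Omega$ is a disc of radius $R$). For $x\in\Omega$ let $s(x)$ be the coordinate of a point $M(s(x))$ of $\partial\Omega$ with $|x-M(s(x))|=\mathrm{dist}(x,\partial\Omega)$ (such a point is unique when $x$ is close enough to $\partial\Omega$). Every $u\in H^1(\Omega)$ (complex-valued) has a trace in $L^2(\partial\Omega)$, namely the $L^2(\partial\Omega)$-limit of $\varphi_n|_{\partial\Omega}$ for some sequence $\varphi_n\in C_c^\infty(\mathbb R^2)$ whose restrictions to $\Omega$ converge to $u$ in $H^1(\Omega)$; it is again denoted by $u$, and for $h>0$ we put $$q_h(u)=\int_\Omega|h\nabla u|^2\,dx-h^{3/2}\int_{\partial\Omega}|u|^2\,ds .$$ There exist constants $C>0$ and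 $h_0\in(0,1)$, depending only on $\Omega$, such that, for all $h\in(0,h_0)$ and all $u\in H^1(\Omega)$, the function $U_h|u|^2$ is integrable on $\Omega$ and $$q_h(u)\ \ge\ \int_\Omega U_h(x)\,|u(x)|^2\,dx ,$$ where $$U_h(x)=\begin{cases}0&\text{if }\ \mathrm{dist}(x,\partial\Omega)>2h^{1/8},\\[2pt] -h-\kappa(s(x))\,h^{3/2}-C\,h^{7/4}&\text{if }\ \mathrm{dist}(x,\partial\Omega)\le 2h^{1/8}.\end{cases}$$ -/

import Mathlib

open MeasureTheory Filter Topology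
open scoped ContDiff

noncomputable section

namespace RobinLaplacian

/-- The Euclidean plane. -/
abbrev Plane := EuclideanSpace ℝ (Fin 2)

/-- Rotation of a vector by `+π/2`. -/
def rot (v : Plane) : Plane := !₂[-v 1, v 0]

/-- `Ω` is an open subset of the plane whose boundary is compact, nonempty and `C^∞`: the boundary
is the disjoint union of `m` simple closed curves, the `j`-th of which is parametrized by
arc-length, with length `L j`, by the periodic smooth map `M j`. The set `Ω` lies locally on one
side of its boundary, and the curves are oriented so that this is the left side: the inward unit
normal at `M j s` is `rot (M j)'(s)`, and the outward unit normal is its opposite. -/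
structure SmoothBoundary (Ω : Set Plane) (m : ℕ) where
  isOpen : IsOpen Ω
  pos : 0 < m
  L : Fin m → ℝ
  M : Fin m → ℝ → Plane
  L_pos : ∀ j, 0 < L j
  smooth : ∀ j, ContDiff ℝ ∞ (M j)
  periodic : ∀ j, Function.Periodic (M j) (L j)
  unit_speed : ∀ j s, ‖deriv (M j) s‖ = 1
  /-- The curves are simple and pairwise disjoint. -/
  injective : ∀ j k s t, M j s = M k t → j = k ∧ ∃ n : ℤ, t = s + n * L j
  frontier_eq : frontier Ω = ⋃ j, Set.range (M j)
  left_mem : ∀ j s, ∀ᶠ t : ℝ in 𝓝[>] 0, M j s + t • rot (deriv (M j) s) ∈ Ω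
  right_notMem : ∀ j s, ∀ᶠ t : ℝ in 𝓝[>] 0, M j s - t • rot (deriv (M j) s) ∉ Ω

namespace SmoothBoundary

variable {Ω : Set Plane} {m : ℕ} (B : SmoothBoundary Ω m)

/-- The signed curvature of the boundary: `T'(s) = κ(s) N(s)`, where `T` is the unit tangent
and `N = rot T` is the inward unit normal. It is positive where `Ω` is strictly convex (it is
`1 / R` for a disc of radius `R`). -/
def curvature (j : Fin m) (s : ℝ) : ℝ :=
  inner ℝ (deriv (deriv (B.M j)) s) (rot (deriv (B.M j) s))

/-- The arc-length measure `ds` on the boundary, as a measure on the plane. -/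
def arcLength : Measure Plane :=
  ∑ j, Measure.map (B.M j) (volume.restrict (Set.Ioc 0 (B.L j)))

/-- Every point of the plane has a nearest point on the boundary. -/
theorem exists_foot (x : Plane) :
    ∃ p : Fin m × ℝ, dist x (B.M p.1 p.2) = Metric.infDist x (frontier Ω) := by
  have hc : IsCompact (frontier Ω) := by
    rw [B.frontier_eq]
    refine isCompact_iUnion fun j => ?_
    rw [← (B.periodic j).image_Icc (B.L_pos j) 0]
    exact isCompact_Icc.image (B.smooth j).continuous
  have hne : (frontier Ω).Nonempty := by
    rw [B.frontier_eq]
    exact ⟨B.M ⟨0, B.pos⟩ 0, Set.mem_iUnion.2 ⟨⟨0, B.pos⟩, 0, rfl⟩⟩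
  obtain ⟨y, hy, hxy⟩ := hc.exists_infDist_eq_dist hne x
  rw [B.frontier_eq] at hy
  obtain ⟨j, s, rfl⟩ := Set.mem_iUnion.1 hy
  exact ⟨(j, s), hxy.symm⟩

/-- The coordinate `s(x)` (with the index of the boundary component): `M (s(x))` is a point of the
boundary at minimal distance from `x`. It is unique up to periods for `x` close to the boundary. -/
def foot (x : Plane) : Fin m × ℝ := (B.exists_foot x).choose

/-- The function `U_h`, with constant `C`. -/
def U (C h : ℝ) (x : Plane) : ℝ :=
  open Classical in
  if Metric.infDist x (frontier Ω) ≤ 2 * h ^ (1 / 8 : ℝ) then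
    -h - B.curvature (B.foot x).1 (B.foot x).2 * h ^ (3 / 2 : ℝ) - C * h ^ (7 / 4 : ℝ)
  else 0

end SmoothBoundary

/-- The partial derivative `∂ᵢ φ` of a differentiable function. -/
def pderiv {F : Type*} [NormedAddCommGroup F] [NormedSpace ℝ F] (i : Fin 2) (φ : Plane → F)
    (x : Plane) : F :=
  fderiv ℝ φ x (EuclideanSpace.single i 1)

/-- `u` belongs to the Sobolev space `H¹(Ω)`, with weak gradient `g = (g 0, g 1)`. -/
structure IsH1 (Ω : Set Plane) (u : Plane → ℂ) (g : Fin 2 → Plane → ℂ) : Prop where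
  memLp : MemLp u 2 (volume.restrict Ω)
  memLp_grad : ∀ i, MemLp (g i) 2 (volume.restrict Ω)
  weak_grad : ∀ i, ∀ φ : Plane → ℝ, ContDiff ℝ ∞ φ → HasCompactSupport φ → tsupport φ ⊆ Ω →
    ∫ x in Ω, pderiv i φ x • u x = -∫ x in Ω, φ x • g i x

/-- `τ ∈ L²(∂Ω)` is the trace on the boundary of the function `u ∈ H¹(Ω)` with weak gradient `g`:
the trace map is the continuous extension to `H¹(Ω)` of the restriction map `φ ↦ φ|_∂Ω`,
`φ ∈ C_c^∞(ℝ²)`. -/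
structure IsTrace {Ω : Set Plane} {m : ℕ} (B : SmoothBoundary Ω m) (u : Plane → ℂ)
    (g : Fin 2 → Plane → ℂ) (τ : Plane → ℂ) : Prop where
  memLp : MemLp τ 2 B.arcLength
  approx : ∃ φ : ℕ → Plane → ℂ,
    (∀ n, ContDiff ℝ ∞ (φ n) ∧ HasCompactSupport (φ n)) ∧
    Tendsto (fun n => eLpNorm (φ n - u) 2 (volume.restrict Ω)) atTop (𝓝 0) ∧
    (∀ i, Tendsto (fun n => eLpNorm (pderiv i (φ n) - g i) 2 (volume.restrict Ω)) atTop (𝓝 0)) ∧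
    Tendsto (fun n => eLpNorm (φ n - τ) 2 B.arcLength) atTop (𝓝 0)

/-- The quadratic form `q_h(u) = ∫_Ω |h ∇u|² dx - h^{3/2} ∫_∂Ω |u|² ds`, for a function with weak
gradient `g` and trace `τ`. -/
def quadForm {Ω : Set Plane} {m : ℕ} (B : SmoothBoundary Ω m) (h : ℝ)
    (g : Fin 2 → Plane → ℂ) (τ : Plane → ℂ) : ℝ :=
  (∫ x in Ω, ∑ i, ‖(h : ℂ) * g i x‖ ^ 2) - h ^ (3 / 2 : ℝ) * ∫ x, ‖τ x‖ ^ 2 ∂B.arcLength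

end RobinLaplacian

end

/-! ### Moving frame along the boundary and separation of the boundary curves -/

noncomputable section

namespace RobinLaplacian

/-! Put h = η⁸, so that h^{1/8}, h^{3/2} and h^{7/4} become η, η¹² and η¹⁴. In normal coordinates x
= M(s) + t N(s), 0 < t < 2η, the area element is (1 - κt) ds dt and |∇u| ≥ |∂ₜu|. The estimate thus
reduces to one normal segment, for a function w of t and a constant κ.

On a segment, take the weight y = (1 - ρ²)² with ρ = t/(2η): it is 1 at the boundary and 0 at the
end of the segment. Integrating the derivative of η¹² y (1 - κt)|w|² turns the boundary term into a
bulk term. Completing the square |η⁸w' + η⁴yw|² ≥ 0 removes w' and leaves the potential (1 -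
κt)(η¹²y' - η⁸y²) - κη¹²y. Where y = 1 this is essentially -h - κh^{3/2}. The cutoff costs about
η¹¹ρ but gains η⁸(1 - y²) ≥ η⁸ρ², and 2η¹¹ρ ≤ η⁸ρ²/2 + 2η¹⁴: this explains both the width h^{1/8}
and the error h^{7/4} (`weight_inequality`, `segment_inequality`).

Integration over s and summation over the boundary curves give the bound for smooth functions
(`lower_bound_smooth`); outside the collars the nonpositive potential is simply dropped. Since U is
bounded, both sides pass to the limit along the approximations that define a trace (`lower_bound`).

Existence of traces rests on two facts. The smooth lower bound at one fixed η is already a trace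
inequality (`exists_trace_inequality`). Restrictions of C_c^∞ functions are dense in H¹(Ω)
(`exists_smooth_approx`): the extension of u by zero is mollified at scale δ and evaluated at a
point shifted inwards by 4δX(x), so that the kernel only sees Ω, and the result is truncated at
infinity. -/

theorem inner_eq (v w : Plane) : inner ℝ v w = v 0 * w 0 + v 1 * w 1 := by
  simp [PiLp.inner_apply, Fin.sum_univ_two, mul_comm]

theorem norm_sq_eq (v : Plane) : ‖v‖ ^ 2 = v 0 ^ 2 + v 1 ^ 2 := by
  rw [← real_inner_self_eq_norm_sq, inner_eq]; ring

@[simp] theorem rot_zero_apply (v : Plane) : rot v 0 = -v 1 := rfl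

@[simp] theorem rot_one_apply (v : Plane) : rot v 1 = v 0 := rfl

/-- Rotation by `+π/2`, as a continuous linear map. -/
def rotL : Plane →L[ℝ] Plane :=
  LinearMap.toContinuousLinearMap
    { toFun := rot
      map_add' := fun v w => by ext i; fin_cases i <;> simp [add_comm]
      map_smul' := fun c v => by ext i; fin_cases i <;> simp }

@[simp] theorem rotL_apply (v : Plane) : rotL v = rot v := rfl

theorem rot_rot (v : Plane) : rot (rot v) = -v := by
  ext i; fin_cases i <;> simp

theorem rot_smul (c : ℝ) (v : Plane) : rot (c • v) = c • rot v := rotL.map_smul c v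

theorem inner_rot_self (v : Plane) : inner ℝ v (rot v) = 0 := by
  rw [inner_eq]; simp; ring

theorem norm_rot (v : Plane) : ‖rot v‖ = ‖v‖ := by
  have h : ‖rot v‖ ^ 2 = ‖v‖ ^ 2 := by
    rw [norm_sq_eq, norm_sq_eq]; simp; ring
  exact (pow_left_inj₀ (norm_nonneg _) (norm_nonneg _) two_ne_zero).1 h

theorem rot_sub (v w : Plane) : rot (v - w) = rot v - rot w := rotL.map_sub v w

/-- The orthogonal decomposition of a vector in the frame `T, rot T`. -/
theorem eq_smul_add_smul_rot {T : Plane} (hT : ‖T‖ = 1) (v : Plane) :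
    v = (inner ℝ v T : ℝ) • T + (inner ℝ v (rot T) : ℝ) • rot T := by
  have h := norm_sq_eq T
  rw [hT] at h
  ext i
  fin_cases i <;> simp [inner_eq]
  · linear_combination (v 0) * h
  · linear_combination (v 1) * h

namespace SmoothBoundary

variable {Ω : Set Plane} {m : ℕ} (B : SmoothBoundary Ω m)

/-- The unit tangent. -/
def tangent (j : Fin m) (s : ℝ) : Plane := deriv (B.M j) s

/-- The inward unit normal. -/
def normal (j : Fin m) (s : ℝ) : Plane := rot (deriv (B.M j) s)

/-- Normal coordinates: the point at signed distance `t` from the boundary point `M j s`. -/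
def tube (j : Fin m) (s t : ℝ) : Plane := B.M j s + t • B.normal j s

theorem norm_tangent (j : Fin m) (s : ℝ) : ‖B.tangent j s‖ = 1 := B.unit_speed j s

theorem norm_normal (j : Fin m) (s : ℝ) : ‖B.normal j s‖ = 1 := by
  rw [normal, norm_rot]; exact B.unit_speed j s

theorem inner_tangent_normal (j : Fin m) (s : ℝ) :
    inner ℝ (B.tangent j s) (B.normal j s) = 0 := inner_rot_self _

theorem contDiff_tangent (j : Fin m) : ContDiff ℝ ∞ (B.tangent j) :=
  (contDiff_infty_iff_deriv.1 (B.smooth j)).2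

theorem contDiff_normal (j : Fin m) : ContDiff ℝ ∞ (B.normal j) :=
  rotL.contDiff.comp (B.contDiff_tangent j)

theorem hasDerivAt_M (j : Fin m) (s : ℝ) : HasDerivAt (B.M j) (B.tangent j s) s :=
  ((B.smooth j).differentiable (by simp) s).hasDerivAt

/-- Differentiating |T|² = 1 shows that T' has no tangential component; its normal component is the
curvature by definition. -/
theorem hasDerivAt_tangent (j : Fin m) (s : ℝ) :
    HasDerivAt (B.tangent j) (B.curvature j s • B.normal j s) s := by
  have hd : HasDerivAt (B.tangent j) (deriv (deriv (B.M j)) s) s :=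
    ((B.contDiff_tangent j).differentiable (by simp) s).hasDerivAt
  have h1 : HasDerivAt (fun s => ‖B.tangent j s‖ ^ 2)
      (2 * inner ℝ (B.tangent j s) (deriv (deriv (B.M j)) s)) s := hd.norm_sq
  simp only [norm_tangent] at h1
  have h2 := h1.unique (hasDerivAt_const s _)
  have h3 : (inner ℝ (deriv (deriv (B.M j)) s) (B.tangent j s) : ℝ) = 0 := by
    rw [real_inner_comm]; linarith
  convert hd using 1
  have h4 := eq_smul_add_smul_rot (B.norm_tangent j s) (deriv (deriv (B.M j)) s)
  rw [h3, zero_smul, zero_add] at h4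
  exact h4.symm

theorem hasDerivAt_normal (j : Fin m) (s : ℝ) :
    HasDerivAt (B.normal j) (-(B.curvature j s) • B.tangent j s) s := by
  have h := rotL.hasFDerivAt.comp_hasDerivAt s (B.hasDerivAt_tangent j s)
  have e : rotL (B.curvature j s • B.normal j s) = -(B.curvature j s) • B.tangent j s := by
    rw [rotL_apply, rot_smul, normal, rot_rot, smul_neg, neg_smul]
    rfl
  rw [e] at h
  exact h

theorem continuous_curvature (j : Fin m) : Continuous (B.curvature j) := by
  have h1 : Continuous (deriv (deriv (B.M j))) :=
    (contDiff_infty_iff_deriv.1 (B.contDiff_tangent j)).2.continuous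
  exact h1.inner (B.contDiff_normal j).continuous

theorem _root_.RobinLaplacian.periodic_deriv {E : Type*} [NormedAddCommGroup E] [NormedSpace ℝ E]
    {f : ℝ → E} {c : ℝ} (h : Function.Periodic f c) : Function.Periodic (deriv f) c := by
  intro s
  rw [← deriv_comp_add_const]
  congr 1
  exact funext h

theorem periodic_tangent (j : Fin m) : Function.Periodic (B.tangent j) (B.L j) :=
  periodic_deriv (B.periodic j)

theorem periodic_normal (j : Fin m) : Function.Periodic (B.normal j) (B.L j) :=
  fun s => congrArg rot (B.periodic_tangent j s)

theorem periodic_curvature (j : Fin m) : Function.Periodic (B.curvature j) (B.L j) := by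
  intro s
  have h1 := periodic_deriv (B.periodic_tangent j) s
  have h2 := B.periodic_normal j s
  change inner ℝ (deriv (B.tangent j) (s + B.L j)) (B.normal j (s + B.L j)) = _
  rw [h1, h2]; rfl

/-- Periodicity reduces the bound to a compact interval. The normalization 1 ≤ K lets the single
smallness condition 16Kη ≤ 1 control η as well. -/
theorem exists_curvature_bound : ∃ K : ℝ, 1 ≤ K ∧ ∀ j s, |B.curvature j s| ≤ K := by
  have h : ∀ j, ∃ K, ∀ s, |B.curvature j s| ≤ K := by
    intro j
    obtain ⟨K, hK⟩ := (isCompact_Icc (a := (0 : ℝ)) (b := 0 + B.L j)).exists_bound_of_continuousOn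
      (B.continuous_curvature j).continuousOn
    refine ⟨K, fun s => ?_⟩
    obtain ⟨s', hs', h⟩ := (B.periodic_curvature j).exists_mem_Ico (B.L_pos j) s 0
    rw [h]
    exact hK s' ⟨hs'.1, hs'.2.le⟩
  choose K hK using h
  refine ⟨1 + ∑ j, |K j|, by linarith [Finset.sum_nonneg fun j (_ : j ∈ Finset.univ) => abs_nonneg (K j)],
    fun j s => ?_⟩
  have := Finset.single_le_sum (f := fun j => |K j|) (fun j _ => abs_nonneg _) (Finset.mem_univ j)
  linarith [hK j s, le_abs_self (K j)]

theorem norm_tangent_sub_le {K : ℝ} (hK : ∀ j s, |B.curvature j s| ≤ K) (j : Fin m) (s s' : ℝ) :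
    ‖B.tangent j s' - B.tangent j s‖ ≤ K * |s' - s| := by
  have := Convex.norm_image_sub_le_of_norm_hasDerivWithin_le (C := K) (s := Set.univ)
    (fun x _ => (B.hasDerivAt_tangent j x).hasDerivWithinAt)
    (fun x _ => by rw [norm_smul, norm_normal, mul_one]; exact hK j x)
    convex_univ (Set.mem_univ s) (Set.mem_univ s')
  simpa using this

theorem norm_normal_sub_le {K : ℝ} (hK : ∀ j s, |B.curvature j s| ≤ K) (j : Fin m) (s s' : ℝ) :
    ‖B.normal j s' - B.normal j s‖ ≤ K * |s' - s| := by
  have h := B.norm_tangent_sub_le hK j s s'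
  rwa [← norm_rot, rot_sub] at h

/-- Mean value inequality for x ↦ M x - (x - s) T(s) between s and s', where the derivative T(x) -
T(s) is at most K|s' - s|. -/
theorem norm_M_sub_sub_le {K : ℝ} (hK : ∀ j s, |B.curvature j s| ≤ K) (j : Fin m) (s s' : ℝ) :
    ‖B.M j s' - B.M j s - (s' - s) • B.tangent j s‖ ≤ K * |s' - s| ^ 2 := by
  have hK0 : 0 ≤ K := (abs_nonneg _).trans (hK j s)
  have := Convex.norm_image_sub_le_of_norm_hasDerivWithin_le (C := K * |s' - s|)
    (s := Set.uIcc s s') (f := fun x => B.M j x - (x - s) • B.tangent j s)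
    (f' := fun x => B.tangent j x - (1 : ℝ) • B.tangent j s)
    (fun x _ => ((B.hasDerivAt_M j x).sub
      (((hasDerivAt_id x).sub_const s).smul_const _)).hasDerivWithinAt)
    (fun x hx => by
      rw [one_smul]
      refine (B.norm_tangent_sub_le hK j s x).trans (mul_le_mul_of_nonneg_left ?_ hK0)
      exact Set.abs_sub_left_of_mem_uIcc hx)
    (convex_uIcc s s') Set.left_mem_uIcc Set.right_mem_uIcc
  rw [sub_self, zero_smul, sub_zero] at this
  calc _ = ‖B.M j s' - (s' - s) • B.tangent j s - B.M j s‖ := by congr 1; abel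
    _ ≤ _ := this
    _ = _ := by rw [Real.norm_eq_abs]; ring

theorem M_mem_frontier (j : Fin m) (s : ℝ) : B.M j s ∈ frontier Ω := by
  rw [B.frontier_eq]; exact Set.mem_iUnion.2 ⟨j, s, rfl⟩

theorem isCompact_frontier (B : SmoothBoundary Ω m) : IsCompact (frontier Ω) := by
  rw [B.frontier_eq]
  refine isCompact_iUnion fun j => ?_
  rw [← (B.periodic j).image_Icc (B.L_pos j) 0]
  exact isCompact_Icc.image (B.smooth j).continuous

/-- Boundary points that are close in the plane have close arc-length coordinates. -/
theorem exists_separation {η : ℝ} (hη : 0 < η) : ∃ r > 0, ∀ j k s s',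
    dist (B.M j s) (B.M k s') < r → j = k ∧ ∃ n : ℤ, |s' + n * B.L j - s| < η := by
  by_contra! H
  -- Counterexamples for radii 1/(n+1), with both parameters translated into one period so that they
  -- stay in a compact set.
  have H' : ∀ n : ℕ, ∃ p : Fin m × Fin m × ℝ × ℝ, p.2.2.1 ∈ Set.Icc 0 (B.L p.1) ∧
      p.2.2.2 ∈ Set.Icc 0 (B.L p.2.1) ∧
      dist (B.M p.1 p.2.2.1) (B.M p.2.1 p.2.2.2) < 1 / ((n : ℝ) + 1) ∧
      (p.1 = p.2.1 → ∀ n : ℤ, η ≤ |p.2.2.2 + n * B.L p.1 - p.2.2.1|) := by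
    intro n
    obtain ⟨j, k, s, s', h1, h2⟩ := H (1 / ((n : ℝ) + 1)) (by positivity)
    obtain ⟨a, ha, -⟩ := existsUnique_add_zsmul_mem_Ico (B.L_pos j) s 0
    obtain ⟨b, hb, -⟩ := existsUnique_add_zsmul_mem_Ico (B.L_pos k) s' 0
    simp only [zero_add] at ha hb
    refine ⟨(j, k, s + a • B.L j, s' + b • B.L k), ⟨ha.1, ha.2.le⟩, ⟨hb.1, hb.2.le⟩, ?_, ?_⟩
    · simpa only [((B.periodic j).zsmul a) s, ((B.periodic k).zsmul b) s'] using h1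
    · intro hjk n
      obtain rfl : j = k := hjk
      have e : s' + b • B.L j + n * B.L j - (s + a • B.L j) =
          s' + (b + n - a : ℤ) * B.L j - s := by
        rw [zsmul_eq_mul, zsmul_eq_mul]; push_cast; ring
      change η ≤ |s' + b • B.L j + n * B.L j - (s + a • B.L j)|
      rw [e]
      exact h2 rfl _
  choose p hp1 hp2 hp3 hp4 using H'
  -- Pigeonhole: the pair of component indices is constant along a subsequence.
  obtain ⟨⟨j, k⟩, hjk⟩ := Finite.exists_infinite_fiber (fun n => ((p n).1, (p n).2.1))
  set A := (fun n => ((p n).1, (p n).2.1)) ⁻¹' {(j, k)} with hA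
  have hAinf : A.Infinite := Set.infinite_coe_iff.1 hjk
  obtain ⟨e, he, heA⟩ := Filter.extraction_of_frequently_atTop
    (Nat.frequently_atTop_iff_infinite.2 hAinf)
  have hj : ∀ n, (p (e n)).1 = j := fun n => congrArg Prod.fst (heA n)
  have hk : ∀ n, (p (e n)).2.1 = k := fun n => congrArg Prod.snd (heA n)
  obtain ⟨⟨s, s'⟩, -, f, hf, hlim⟩ :=
    ((isCompact_Icc (a := (0 : ℝ)) (b := B.L j)).prod
      (isCompact_Icc (a := (0 : ℝ)) (b := B.L k))).tendsto_subseq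
      (x := fun n => ((p (e n)).2.2.1, (p (e n)).2.2.2))
      (fun n => ⟨by simpa only [hj] using hp1 (e n), by simpa only [hk] using hp2 (e n)⟩)
  have l1 : Tendsto (fun n => (p (e (f n))).2.2.1) atTop (𝓝 s) :=
    (continuous_fst.tendsto (s, s')).comp hlim
  have l2 : Tendsto (fun n => (p (e (f n))).2.2.2) atTop (𝓝 s') :=
    (continuous_snd.tendsto (s, s')).comp hlim
  have hM : B.M j s = B.M k s' := by
    have c1 := ((B.smooth j).continuous.tendsto s).comp l1
    have c2 := ((B.smooth k).continuous.tendsto s').comp l2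
    have c3 := c1.dist c2
    have c4 : Tendsto (fun n => 1 / (((e (f n) : ℕ) : ℝ) + 1)) atTop (𝓝 0) :=
      tendsto_one_div_add_atTop_nhds_zero_nat.comp (he.tendsto_atTop.comp hf.tendsto_atTop)
    have c5 := le_of_tendsto_of_tendsto' c3 c4 (fun n => by
      have := hp3 (e (f n))
      rw [hj, hk] at this
      exact this.le)
    exact dist_le_zero.1 c5
  -- The limit parameters differ by n periods, so the differences shifted by -n periods tend to 0
  -- although they are all at least η.
  obtain ⟨rfl, n, hn⟩ := B.injective _ _ _ _ hM
  have c6 : Tendsto (fun i => |(p (e (f i))).2.2.2 + (-n : ℤ) * B.L j - (p (e (f i))).2.2.1|) atTop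
      (𝓝 |s' + (-n : ℤ) * B.L j - s|) := ((l2.add_const _).sub l1).abs
  have c7 := ge_of_tendsto' c6 (fun i => by
    have := hp4 (e (f i)) (by rw [hj, hk]) (-n)
    rwa [hj] at this)
  rw [hn] at c7
  push_cast at c7
  have : s + n * B.L j + -n * B.L j - s = 0 := by ring
  rw [this, abs_zero] at c7
  linarith

end SmoothBoundary
end RobinLaplacian
end

/-! ### Tubular neighbourhood and interior cones -/

noncomputable section

namespace RobinLaplacian
namespace SmoothBoundary

variable {Ω : Set Plane} {m : ℕ} (B : SmoothBoundary Ω m)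

/-- `ε` is a radius for which the normal coordinates are injective (up to periods). -/
structure IsTubeRadius (ε : ℝ) : Prop where
  pos : 0 < ε
  inj : ∀ j k s s' t t', |t| ≤ ε → |t'| ≤ ε → B.tube j s t = B.tube k s' t' →
    j = k ∧ (∃ n : ℤ, s' = s + n * B.L j) ∧ t = t'

theorem M_add_int_mul (j : Fin m) (s : ℝ) (n : ℤ) : B.M j (s + n * B.L j) = B.M j s :=
  (B.periodic j).int_mul n s

theorem normal_add_int_mul (j : Fin m) (s : ℝ) (n : ℤ) :
    B.normal j (s + n * B.L j) = B.normal j s :=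
  (B.periodic_normal j).int_mul n s

theorem tube_add_int_mul (j : Fin m) (s t : ℝ) (n : ℤ) :
    B.tube j (s + n * B.L j) t = B.tube j s t := by
  rw [tube, M_add_int_mul, normal_add_int_mul, tube]

theorem norm_tube_sub (j : Fin m) (s t : ℝ) : ‖B.tube j s t - B.M j s‖ = |t| := by
  rw [tube, add_sub_cancel_left, norm_smul, norm_normal, mul_one, Real.norm_eq_abs]

theorem continuous_tube (j : Fin m) : Continuous fun p : ℝ × ℝ => B.tube j p.1 p.2 :=
  ((B.smooth j).continuous.comp continuous_fst).add
    (continuous_snd.smul ((B.contDiff_normal j).continuous.comp continuous_fst))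

/-- If two normal segments of length at most ε meet, their feet are closer than r, hence on the same
curve with parameters at distance d < 1/(4K) up to periods. Projecting the equality of the two
points on the tangent at s gives d ≤ K d² + εK d ≤ d/2, so d = 0. -/
theorem exists_isTubeRadius : ∃ ε, B.IsTubeRadius ε := by
  obtain ⟨K, hK1, hK⟩ := B.exists_curvature_bound
  have hK0 : 0 < K := by linarith
  obtain ⟨r, hr, hsep⟩ := B.exists_separation (η := 1 / (4 * K)) (by positivity)
  have hεpos : 0 < min (r / 4) (1 / (4 * K)) := by positivity
  refine ⟨min (r / 4) (1 / (4 * K)), hεpos, ?_⟩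
  intro j k s s' t t' ht ht' h
  have hε1 := min_le_left (r / 4) (1 / (4 * K))
  have hε2 := min_le_right (r / 4) (1 / (4 * K))
  set ε := min (r / 4) (1 / (4 * K))
  have hd : dist (B.M j s) (B.M k s') < r := by
    have h1 := dist_triangle (B.M j s) (B.tube j s t) (B.M k s')
    have h2 : dist (B.M j s) (B.tube j s t) = |t| := by
      rw [dist_comm, dist_eq_norm, norm_tube_sub]
    have h3 : dist (B.tube j s t) (B.M k s') = |t'| := by
      rw [h, dist_eq_norm, norm_tube_sub]
    linarith
  obtain ⟨rfl, n, hn⟩ := hsep j k s s' hd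
  rw [← tube_add_int_mul B j s' t' n] at h
  have hmain : s' + n * B.L j = s := by
    set s'' := s' + n * B.L j with hs''
    have e1 := B.norm_M_sub_sub_le hK j s s''
    have e2 := B.norm_normal_sub_le hK j s s''
    have e3 : (inner ℝ (B.M j s'' - B.M j s - (s'' - s) • B.tangent j s) (B.tangent j s) : ℝ)
        + (s'' - s) = - t' * inner ℝ (B.normal j s'' - B.normal j s) (B.tangent j s) := by
      have : B.M j s'' - B.M j s = t • B.normal j s - t' • B.normal j s'' := by
        rw [sub_eq_sub_iff_add_eq_add, add_comm _ (B.M j s)]; exact h.symm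
      rw [this]
      simp only [inner_sub_left, inner_smul_left, real_inner_self_eq_norm_sq, norm_tangent,
        real_inner_comm (B.tangent j s) (B.normal j s), inner_tangent_normal]
      simp
    have e4 := abs_real_inner_le_norm (B.M j s'' - B.M j s - (s'' - s) • B.tangent j s)
      (B.tangent j s)
    have e5 := abs_real_inner_le_norm (B.normal j s'' - B.normal j s) (B.tangent j s)
    rw [norm_tangent, mul_one] at e4 e5
    have e6 : |s'' - s| ≤ K * |s'' - s| ^ 2 + ε * (K * |s'' - s|) := by
      have : s'' - s = - t' * inner ℝ (B.normal j s'' - B.normal j s) (B.tangent j s) -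
        inner ℝ (B.M j s'' - B.M j s - (s'' - s) • B.tangent j s) (B.tangent j s) := by linarith
      calc |s'' - s| ≤ |t'| * |inner ℝ (B.normal j s'' - B.normal j s) (B.tangent j s)| + 
          |inner ℝ (B.M j s'' - B.M j s - (s'' - s) • B.tangent j s) (B.tangent j s)| := by
            conv_lhs => rw [this]
            refine (abs_sub _ _).trans (le_of_eq ?_)
            rw [abs_mul, abs_neg]
        _ ≤ ε * (K * |s'' - s|) + K * |s'' - s| ^ 2 :=
          add_le_add (mul_le_mul ht' (e5.trans e2) (abs_nonneg _) hεpos.le) (e4.trans e1)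
        _ = _ := by ring
    have hKK : K * (1 / (4 * K)) = 1 / 4 := by field_simp
    have e7 : K * |s'' - s| ≤ 1 / 4 := by
      rw [← hKK]; exact mul_le_mul_of_nonneg_left hn.le hK0.le
    have e8 : ε * K ≤ 1 / 4 := by
      rw [← hKK, mul_comm]; exact mul_le_mul_of_nonneg_left hε2 hK0.le
    have e9 : |s'' - s| ≤ 0 := by nlinarith [abs_nonneg (s'' - s)]
    have := abs_eq_zero.1 (le_antisymm e9 (abs_nonneg _))
    linarith
  refine ⟨rfl, ⟨-n, by push_cast; linarith⟩, ?_⟩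
  rw [hmain, tube, tube, add_right_inj] at h
  have h0 : B.normal j s ≠ 0 := by
    intro h0; have := B.norm_normal j s; rw [h0, norm_zero] at this; exact zero_ne_one this
  exact smul_left_injective ℝ h0 h

/-- A nearest boundary point is the foot of a perpendicular. -/
theorem eq_tube_of_dist_eq {x : Plane} {j : Fin m} {s : ℝ}
    (h : dist x (B.M j s) = Metric.infDist x (frontier Ω)) :
    ∃ t, x = B.tube j s t ∧ |t| = Metric.infDist x (frontier Ω) := by
  have hmin : IsLocalMin (fun s => ‖x - B.M j s‖ ^ 2) s := by
    refine Filter.Eventually.of_forall fun s' => ?_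
    have : dist x (B.M j s) ≤ dist x (B.M j s') := by
      rw [h]; exact Metric.infDist_le_dist_of_mem (B.M_mem_frontier j s')
    rw [dist_eq_norm, dist_eq_norm] at this
    exact pow_le_pow_left₀ (norm_nonneg _) this 2
  have hd := ((hasDerivAt_const s x).sub (B.hasDerivAt_M j s)).norm_sq
  have h0 := hmin.hasDerivAt_eq_zero hd
  rw [Pi.sub_apply, zero_sub, inner_neg_right] at h0
  have h1 := eq_smul_add_smul_rot (B.norm_tangent j s) (x - B.M j s)
  have h2 : (inner ℝ (x - B.M j s) (B.tangent j s) : ℝ) = 0 := by linarith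
  rw [h2, zero_smul, zero_add] at h1
  have hx : x = B.tube j s (inner ℝ (x - B.M j s) (B.normal j s)) := by
    rw [tube]; exact (sub_eq_iff_eq_add'.1 h1)
  refine ⟨_, hx, ?_⟩
  rw [← h, dist_eq_norm]
  conv_rhs => rw [hx]
  rw [norm_tube_sub]

theorem foot_spec (x : Plane) :
    dist x (B.M (B.foot x).1 (B.foot x).2) = Metric.infDist x (frontier Ω) :=
  (B.exists_foot x).choose_spec

variable {B} {ε : ℝ}

/-- A nearest boundary point yields a second representation in normal coordinates, with a parameter
no larger than |t|. Injectivity of the coordinates identifies the two. -/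
theorem IsTubeRadius.infDist_tube (hε : B.IsTubeRadius ε) (j : Fin m) (s : ℝ) {t : ℝ}
    (ht : |t| ≤ ε) : Metric.infDist (B.tube j s t) (frontier Ω) = |t| := by
  obtain ⟨t', h1, h2⟩ := B.eq_tube_of_dist_eq (B.foot_spec (B.tube j s t))
  have h3 : Metric.infDist (B.tube j s t) (frontier Ω) ≤ |t| := by
    refine (Metric.infDist_le_dist_of_mem (B.M_mem_frontier j s)).trans ?_
    rw [dist_eq_norm, norm_tube_sub]
  rw [← h2] at h3
  obtain ⟨-, -, rfl⟩ := hε.inj _ _ _ _ _ _ ht (h3.trans ht) h1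
  exact h2.symm

theorem IsTubeRadius.foot_tube (hε : B.IsTubeRadius ε) (j : Fin m) (s : ℝ) {t : ℝ}
    (ht : |t| ≤ ε) :
    ∃ n : ℤ, B.foot (B.tube j s t) = (j, s + n * B.L j) := by
  obtain ⟨t', h1, h2⟩ := B.eq_tube_of_dist_eq (B.foot_spec (B.tube j s t))
  rw [hε.infDist_tube j s ht] at h2
  obtain ⟨h3, ⟨n, hn⟩, -⟩ := hε.inj _ _ _ _ _ _ ht (h2.trans_le ht) h1
  exact ⟨n, Prod.ext h3.symm hn⟩

theorem IsTubeRadius.curvature_foot_tube (hε : B.IsTubeRadius ε) (j : Fin m) (s : ℝ) {t : ℝ}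
    (ht : |t| ≤ ε) :
    B.curvature (B.foot (B.tube j s t)).1 (B.foot (B.tube j s t)).2 = B.curvature j s := by
  obtain ⟨n, hn⟩ := hε.foot_tube j s ht
  rw [hn]
  exact (B.periodic_curvature j).int_mul n s

theorem IsTubeRadius.tube_notMem_frontier (hε : B.IsTubeRadius ε) (j : Fin m) (s : ℝ) {t : ℝ}
    (ht : |t| ≤ ε) (h0 : t ≠ 0) : B.tube j s t ∉ frontier Ω := by
  intro h
  have := Metric.infDist_zero_of_mem h
  rw [hε.infDist_tube j s ht, abs_eq_zero] at this
  exact h0 this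

/-- A preconnected set that misses the boundary and meets `Ω` is contained in `Ω`. -/
theorem _root_.RobinLaplacian.subset_of_isPreconnected {X : Type*} [TopologicalSpace X]
    {Ω S : Set X} (hΩ : IsOpen Ω) (hS : IsPreconnected S) (hd : ∀ x ∈ S, x ∉ frontier Ω) {x : X}
    (hx : x ∈ S) (hxΩ : x ∈ Ω) : S ⊆ Ω := by
  refine hS.subset_left_of_subset_union hΩ (isClosed_closure (s := Ω)).isOpen_compl ?_ ?_
    ⟨x, hx, hxΩ⟩
  · exact Set.disjoint_left.2 fun y hy hy' => hy' (subset_closure hy)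
  · intro y hy
    by_contra h
    rw [Set.mem_union, not_or] at h
    refine hd y hy ?_
    rw [hΩ.frontier_eq]
    exact ⟨not_not.1 h.2, h.1⟩

/-- The normal segment with its foot removed is connected and misses the boundary, and `left_mem`
places one of its points in Ω. -/
theorem IsTubeRadius.tube_mem (hε : B.IsTubeRadius ε) (j : Fin m) (s : ℝ) {t : ℝ}
    (h0 : 0 < t) (ht : t ≤ ε) : B.tube j s t ∈ Ω := by
  have hc : Continuous fun t => B.tube j s t :=
    (B.continuous_tube j).comp (continuous_const.prodMk continuous_id)
  obtain ⟨t', ht'1, ht'2, ht'3⟩ := ((B.left_mem j s).and (Ioc_mem_nhdsGT h0)).exists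
  refine subset_of_isPreconnected B.isOpen (isPreconnected_Ioc (a := 0) (b := t) |>.image _ hc.continuousOn)
    ?_ ⟨t', ⟨ht'2, ht'3⟩, rfl⟩ ht'1 ⟨t, ⟨h0, le_rfl⟩, rfl⟩
  rintro _ ⟨r, hr, rfl⟩
  exact hε.tube_notMem_frontier j s (by rw [abs_of_pos hr.1]; exact hr.2.trans ht) hr.1.ne'

theorem IsTubeRadius.tube_notMem (hε : B.IsTubeRadius ε) (j : Fin m) (s : ℝ) {t : ℝ}
    (h0 : t ≤ 0) (ht : -ε ≤ t) : B.tube j s t ∉ Ω := by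
  intro h
  rcases h0.eq_or_lt with rfl | h0
  · have := B.M_mem_frontier j s
    rw [B.isOpen.frontier_eq] at this
    simp only [tube, zero_smul, add_zero] at h
    exact this.2 h
  have hc : Continuous fun t => B.tube j s t :=
    (B.continuous_tube j).comp (continuous_const.prodMk continuous_id)
  obtain ⟨t', ht'1, ht'2, ht'3⟩ := ((B.right_notMem j s).and
    (Ioc_mem_nhdsGT (show 0 < -t by linarith))).exists
  have := subset_of_isPreconnected B.isOpen
    (isPreconnected_Ico (a := t) (b := 0) |>.image _ hc.continuousOn)
    ?_ ⟨t, ⟨le_rfl, h0⟩, rfl⟩ h ⟨-t', ⟨by linarith, by linarith⟩, rfl⟩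
  · refine ht'1 ?_
    simp only [tube, neg_smul, ← sub_eq_add_neg] at this
    exact this
  rintro _ ⟨r, hr, rfl⟩
  exact hε.tube_notMem_frontier j s (by rw [abs_of_neg hr.2]; linarith [hr.1]) hr.2.ne

/-- Points of `Ω` close to the boundary in normal coordinates. -/
theorem IsTubeRadius.exists_eq_tube (hε : B.IsTubeRadius ε) {x : Plane} (hx : x ∈ Ω)
    (hd : Metric.infDist x (frontier Ω) ≤ ε) :
    ∃ j s t, 0 < t ∧ t = Metric.infDist x (frontier Ω) ∧ x = B.tube j s t := by
  obtain ⟨t, h1, h2⟩ := B.eq_tube_of_dist_eq (B.foot_spec x)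
  have ht : |t| ≤ ε := h2.trans_le hd
  have h3 : 0 < t := by
    by_contra h
    refine hε.tube_notMem (B.foot x).1 (B.foot x).2 (not_lt.1 h) (abs_le.1 ht).1 ?_
    rwa [← h1]
  exact ⟨_, _, t, h3, by rw [← h2, abs_of_pos h3], h1⟩

variable (B)

/-- Uniform interior cone property. -/
theorem exists_cone {c : ℝ} (hc : 0 < c) : ∃ r > 0, ∀ j s y, ‖y - B.M j s‖ ≤ r →
    0 < (inner ℝ (B.normal j s) (y - B.M j s) : ℝ) →
    c * ‖y - B.M j s‖ ≤ inner ℝ (B.normal j s) (y - B.M j s) → y ∈ Ω := by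
  obtain ⟨K, hK1, hK⟩ := B.exists_curvature_bound
  have hK0 : 0 < K := by linarith
  -- The first bound makes a chord at least half as long as its arc; the second keeps the normal
  -- deviation K d² of the curve below the slope required in the cone.
  set η := min (1 / (2 * K)) (c / (4 * K)) with hηdef
  have hη : 0 < η := by positivity
  obtain ⟨r, hr, hsep⟩ := B.exists_separation hη
  refine ⟨r / 2, by positivity, ?_⟩
  intro j s y hy hy0 hyc
  -- The truncated cone S is convex and misses the boundary. For c ≤ 1 it contains a short piece of
  -- the normal, which meets Ω, so it lies in Ω by connectedness.
  set S : Set Plane := {y | ‖y - B.M j s‖ ≤ r / 2 ∧ 0 < (inner ℝ (B.normal j s) (y - B.M j s) : ℝ) ∧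
    c * ‖y - B.M j s‖ ≤ inner ℝ (B.normal j s) (y - B.M j s)} with hS
  have hconv : Convex ℝ S := by
    intro a ha b hb α β hα hβ hαβ
    have e : α • a + β • b - B.M j s = α • (a - B.M j s) + β • (b - B.M j s) := by
      rw [show α = 1 - β by linarith]; module
    have en : ‖α • (a - B.M j s) + β • (b - B.M j s)‖ ≤
        α * ‖a - B.M j s‖ + β * ‖b - B.M j s‖ := by
      refine (norm_add_le _ _).trans (le_of_eq ?_)
      rw [norm_smul, norm_smul, Real.norm_of_nonneg hα, Real.norm_of_nonneg hβ]
    have ei : (inner ℝ (B.normal j s) (α • (a - B.M j s) + β • (b - B.M j s)) : ℝ) =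
        α * inner ℝ (B.normal j s) (a - B.M j s) + β * inner ℝ (B.normal j s) (b - B.M j s) := by
      rw [inner_add_right, inner_smul_right, inner_smul_right]
    obtain ⟨a1, a2, a3⟩ := ha
    obtain ⟨b1, b2, b3⟩ := hb
    have hα' : α = 1 - β := by linarith
    refine ⟨?_, ?_, ?_⟩
    · rw [e]; refine en.trans ?_
      nlinarith
    · rw [e, ei]
      rcases hα.eq_or_lt with h | h
      · have : β = 1 := by linarith
        rw [← h, this]; linarith
      · nlinarith [mul_pos h a2, mul_nonneg hβ b2.le]
    · rw [e, ei]
      refine (mul_le_mul_of_nonneg_left en hc.le).trans ?_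
      nlinarith [mul_le_mul_of_nonneg_left a3 hα, mul_le_mul_of_nonneg_left b3 hβ]
  have hfr : ∀ z ∈ S, z ∉ frontier Ω := by
    rintro z ⟨h1, h2, h3⟩ hz
    rw [B.frontier_eq] at hz
    obtain ⟨k, s', rfl⟩ := Set.mem_iUnion.1 hz
    obtain ⟨rfl, n, hn⟩ := hsep j k s s' (by rw [dist_comm, dist_eq_norm]; linarith)
    rw [← M_add_int_mul B j s' n] at h1 h2 h3
    set s'' := s' + n * B.L j
    have e1 := B.norm_M_sub_sub_le hK j s s''
    set d := s'' - s with hd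
    have e2 : (inner ℝ (B.normal j s) (B.M j s'' - B.M j s) : ℝ) ≤ K * |d| ^ 2 := by
      have : (inner ℝ (B.normal j s) (B.M j s'' - B.M j s) : ℝ) =
          inner ℝ (B.normal j s) (B.M j s'' - B.M j s - d • B.tangent j s) := by
        rw [inner_sub_right _ _ (d • B.tangent j s), inner_smul_right, real_inner_comm,
          real_inner_comm (B.tangent j s), inner_tangent_normal, mul_zero, sub_zero]
      rw [this]
      refine (real_inner_le_norm _ _).trans ?_
      rw [norm_normal, one_mul]; exact e1
    have e3 : |d| - K * |d| ^ 2 ≤ ‖B.M j s'' - B.M j s‖ := by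
      have := norm_sub_norm_le (d • B.tangent j s) (d • B.tangent j s - (B.M j s'' - B.M j s))
      rw [sub_sub_cancel, norm_smul, norm_tangent, mul_one, Real.norm_eq_abs, norm_sub_rev] at this
      linarith
    have e4 : K * |d| ≤ 1 / 2 := by
      have := mul_le_mul_of_nonneg_left (hn.le.trans (min_le_left _ _)) hK0.le
      rwa [show K * (1 / (2 * K)) = 1 / 2 by field_simp] at this
    have e5 : K * |d| ≤ c / 4 := by
      have := mul_le_mul_of_nonneg_left (hn.le.trans (min_le_right _ _)) hK0.le
      rwa [show K * (c / (4 * K)) = c / 4 by field_simp] at this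
    have e6 : |d| / 2 ≤ ‖B.M j s'' - B.M j s‖ := by nlinarith [abs_nonneg d]
    have e7 : c * (|d| / 2) ≤ |d| * (c / 4) := by
      calc c * (|d| / 2) ≤ c * ‖B.M j s'' - B.M j s‖ := mul_le_mul_of_nonneg_left e6 hc.le
        _ ≤ K * |d| ^ 2 := h3.trans e2
        _ = |d| * (K * |d|) := by ring
        _ ≤ _ := mul_le_mul_of_nonneg_left e5 (abs_nonneg _)
    have e8 : 0 < |d| := by
      rw [abs_pos]; intro h
      rw [h, abs_zero] at e2
      linarith
    nlinarith [mul_pos hc e8]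
  by_cases hc1 : c ≤ 1
  · obtain ⟨t, ht1, ht2, ht3⟩ := ((B.left_mem j s).and
      (Ioc_mem_nhdsGT (show 0 < r / 2 by positivity))).exists
    refine subset_of_isPreconnected B.isOpen hconv.isPreconnected hfr ?_ ht1 ⟨hy, hy0, hyc⟩
    have e : B.M j s + t • rot (deriv (B.M j) s) - B.M j s = t • B.normal j s := by
      rw [add_sub_cancel_left]; rfl
    have e' : (inner ℝ (B.normal j s) (t • B.normal j s) : ℝ) = t := by
      rw [inner_smul_right, real_inner_self_eq_norm_sq, norm_normal]; ring
    have e'' : ‖t • B.normal j s‖ = t := by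
      rw [norm_smul, norm_normal, mul_one, Real.norm_of_nonneg ht2.le]
    refine ⟨?_, ?_, ?_⟩
    · rw [e, e'']; exact ht3
    · rw [e, e']; exact ht2
    · rw [e, e', e'']; nlinarith
  -- For c > 1 the cone is empty, by Cauchy–Schwarz.
  · exfalso
    have := real_inner_le_norm (B.normal j s) (y - B.M j s)
    rw [norm_normal, one_mul] at this
    nlinarith

end SmoothBoundary
end RobinLaplacian
end

/-! ### The inequality on a normal segment -/

noncomputable section

namespace RobinLaplacian

/-- The constant in the lower bound, in terms of a bound on the curvature. -/
def lowerConst (K : ℝ) : ℝ := 4 + 16 * K ^ 4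

/-- The differential inequality satisfied by the weight `η¹² (1 - ρ²)²`, with `ρ = t / (2η)`. -/
theorem weight_inequality {K κ η ρ : ℝ} (hK : 1 ≤ K) (hκ : |κ| ≤ K) (hη : 0 < η)
    (hη1 : 16 * K * η ≤ 1) (hρ0 : 0 ≤ ρ) (hρ1 : ρ ≤ 1) :
    (1 - κ * (2 * η * ρ)) * (-η ^ 8 - κ * η ^ 12 - lowerConst K * η ^ 14) ≤
      (1 - κ * (2 * η * ρ)) * (-2 * η ^ 11 * ρ * (1 - ρ ^ 2)) - κ * (η ^ 12 * (1 - ρ ^ 2) ^ 2)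
        - (1 - κ * (2 * η * ρ)) * η ^ 8 * ((1 - ρ ^ 2) ^ 2) ^ 2 := by
  -- With C = `lowerConst K`, the claim rearranges to 0 ≤ J (η⁸(1 - y²) - 2η¹¹ρ(1 - ρ²) + Cη¹⁴) +
  -- κη¹²(J - y). The last summand is a perturbation, small because J - y vanishes at ρ = 0.
  set J := 1 - κ * (2 * η * ρ) with hJ
  set y := (1 - ρ ^ 2) ^ 2 with hy
  have hK0 : 0 < K := by linarith
  obtain ⟨hκ1, hκ2⟩ := abs_le.1 hκ
  have hη16 : η ≤ 1 / 16 := by nlinarith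
  have hηρ : 0 ≤ η * ρ := by positivity
  have hJ1 : 1 / 2 ≤ J := by
    have : κ * (η * ρ) ≤ K * (η * 1) :=
      mul_le_mul hκ2 (mul_le_mul_of_nonneg_left hρ1 hη.le) hηρ hK0.le
    rw [hJ]; nlinarith
  have hρ2 : ρ ^ 2 ≤ 1 := by nlinarith
  have hy1 : 1 - y ^ 2 ≥ ρ ^ 2 := by
    have h1 : 0 ≤ 1 - ρ ^ 2 := by linarith
    have h2 : y ≤ 1 - ρ ^ 2 := by rw [hy]; nlinarith [sq_nonneg ρ]
    have h3 : 0 ≤ y := sq_nonneg _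
    nlinarith [sq_nonneg ρ]
  have hy2 : |J - y| ≤ 2 * ρ ^ 2 + 2 * K * η * ρ := by
    have h1 : |1 - y| ≤ 2 * ρ ^ 2 := by
      rw [abs_le, hy]; constructor <;> nlinarith [sq_nonneg ρ, sq_nonneg (ρ ^ 2)]
    have h2 : |κ * (2 * η * ρ)| ≤ 2 * K * η * ρ := by
      rw [abs_mul, abs_of_nonneg (show 0 ≤ 2 * η * ρ by positivity)]
      nlinarith [mul_le_mul_of_nonneg_right hκ hηρ]
    have h3 : J - y = (1 - y) - κ * (2 * η * ρ) := by rw [hJ]; ring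
    rw [h3]
    exact (abs_sub _ _).trans (add_le_add h1 h2)
  have hpert : -(η ^ 12 * (K * (2 * ρ ^ 2 + 2 * K * η * ρ))) ≤ κ * η ^ 12 * (J - y) := by
    have h1 : |κ * η ^ 12 * (J - y)| ≤ η ^ 12 * (K * (2 * ρ ^ 2 + 2 * K * η * ρ)) := by
      rw [abs_mul, abs_mul, abs_of_pos (pow_pos hη 12), mul_comm |κ|, mul_assoc]
      exact mul_le_mul_of_nonneg_left (mul_le_mul hκ hy2 (abs_nonneg _) hK0.le) (by positivity)
    exact (abs_le.1 h1).1
  -- The square η⁸(ρ - 2η³)² absorbs the cost 2η¹¹ρ of the cutoff into half of the gain η⁸ρ² plus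
  -- 2η¹⁴.
  have hA : 1 / 2 * η ^ 8 * ρ ^ 2 + (2 + 16 * K ^ 4) * η ^ 14 ≤
      η ^ 8 * (1 - y ^ 2) - 2 * η ^ 11 * ρ * (1 - ρ ^ 2) + lowerConst K * η ^ 14 := by
    have h1 : η ^ 8 * ρ ^ 2 ≤ η ^ 8 * (1 - y ^ 2) :=
      mul_le_mul_of_nonneg_left hy1 (by positivity)
    have h2 : 2 * η ^ 11 * ρ * (1 - ρ ^ 2) ≤ 2 * η ^ 11 * ρ := by
      have : 0 ≤ 2 * η ^ 11 * ρ := by positivity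
      nlinarith [sq_nonneg ρ]
    have h3 : 0 ≤ η ^ 8 * (ρ - 2 * η ^ 3) ^ 2 := by positivity
    have h4 : η ^ 8 * (ρ - 2 * η ^ 3) ^ 2 = η ^ 8 * ρ ^ 2 - 4 * η ^ 11 * ρ + 4 * η ^ 14 := by ring
    rw [lowerConst]
    linarith
  -- The square η⁸(ρ - 8K²η⁵)² bounds 2K²η¹³ρ by η⁸ρ²/8 + 8K⁴η¹⁸; this is what the 16K⁴ in
  -- `lowerConst` pays for. The outer factor 1/2 anticipates J ≥ 1/2.
  have hB : η ^ 12 * (K * (2 * ρ ^ 2 + 2 * K * η * ρ)) ≤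
      1 / 2 * (1 / 2 * η ^ 8 * ρ ^ 2 + (2 + 16 * K ^ 4) * η ^ 14) := by
    have h1 : 2 * K * η ^ 4 ≤ 1 / 8 := by
      have : η ^ 4 ≤ η := by
        have : η ^ 3 ≤ 1 := pow_le_one₀ hη.le (by linarith)
        nlinarith
      nlinarith
    have h2 : η ^ 12 * K * (2 * ρ ^ 2) ≤ 1 / 8 * (η ^ 8 * ρ ^ 2) := by
      have : 0 ≤ η ^ 8 * ρ ^ 2 := by positivity
      nlinarith
    have h3 : 0 ≤ η ^ 8 * (ρ - 8 * K ^ 2 * η ^ 5) ^ 2 := by positivity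
    have h4 : η ^ 8 * (ρ - 8 * K ^ 2 * η ^ 5) ^ 2 =
      η ^ 8 * ρ ^ 2 - 16 * K ^ 2 * η ^ 13 * ρ + 64 * K ^ 4 * η ^ 18 := by ring
    have h5 : η ^ 18 ≤ η ^ 14 := pow_le_pow_of_le_one hη.le (by linarith) (by norm_num)
    have h6 : K ^ 4 * η ^ 18 ≤ K ^ 4 * η ^ 14 := mul_le_mul_of_nonneg_left h5 (by positivity)
    have h7 : 0 ≤ η ^ 14 := by positivity
    nlinarith
  have hC : 1 / 2 * (1 / 2 * η ^ 8 * ρ ^ 2 + (2 + 16 * K ^ 4) * η ^ 14) ≤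
      J * (η ^ 8 * (1 - y ^ 2) - 2 * η ^ 11 * ρ * (1 - ρ ^ 2) + lowerConst K * η ^ 14) :=
    mul_le_mul hJ1 hA (by positivity) (by linarith)
  nlinarith

/-- The function G = η¹² y (1 - κt)|w|² equals η¹²|w(0)|² at 0 and vanishes at 2η, so -η¹²|w(0)|² is
the integral of G'. Adding (1 - κt)η¹⁶|w'|² and completing the square leaves a potential times |w|²,
which `weight_inequality` bounds pointwise. -/
theorem segment_inequality {K κ η : ℝ} (hK : 1 ≤ K) (hκ : |κ| ≤ K) (hη : 0 < η)
    (hη1 : 16 * K * η ≤ 1) {w w' : ℝ → ℂ} (hw : ∀ t, HasDerivAt w (w' t) t)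
    (hw' : Continuous w') :
    ∫ t in (0 : ℝ)..(2 * η),
      (1 - κ * t) * ((-η ^ 8 - κ * η ^ 12 - lowerConst K * η ^ 14) * ‖w t‖ ^ 2) ≤
    (∫ t in (0 : ℝ)..(2 * η), (1 - κ * t) * (η ^ 16 * ‖w' t‖ ^ 2)) - η ^ 12 * ‖w 0‖ ^ 2 := by
  have hwc : Continuous w := continuous_iff_continuousAt.2 fun t => (hw t).continuousAt
  set y : ℝ → ℝ := fun t => (1 - (t / (2 * η)) ^ 2) ^ 2 with hy
  set y' : ℝ → ℝ := fun t => -2 * (t / (2 * η)) * (1 - (t / (2 * η)) ^ 2) / η with hy'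
  have hyd : ∀ t, HasDerivAt y (y' t) t := by
    intro t
    have h1 := ((((hasDerivAt_id t).div_const (2 * η)).pow 2).const_sub 1).pow 2
    refine h1.congr_deriv ?_
    simp only [hy', id, Pi.pow_apply]
    generalize t / (2 * η) = ρ
    norm_num
    field_simp
  have hyc : Continuous y := by fun_prop
  have hyc' : Continuous y' := by fun_prop
  set G : ℝ → ℝ := fun t => η ^ 12 * y t * (1 - κ * t) * ‖w t‖ ^ 2 with hG
  set G' : ℝ → ℝ := fun t => (η ^ 12 * y' t * (1 - κ * t) + η ^ 12 * y t * (-κ)) * ‖w t‖ ^ 2 +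
    η ^ 12 * y t * (1 - κ * t) * (2 * inner ℝ (w t) (w' t)) with hG'
  have hGd : ∀ t, HasDerivAt G (G' t) t := by
    intro t
    have h1 : HasDerivAt (fun t => 1 - κ * t) (-κ) t := by
      simpa using ((hasDerivAt_id t).const_mul κ).const_sub 1
    exact (((hyd t).const_mul _).mul h1).mul (hw t).norm_sq
  have hGc' : Continuous G' := by
    have := hwc.inner (𝕜 := ℝ) hw'
    fun_prop
  have hint := intervalIntegral.integral_eq_sub_of_hasDerivAt (a := 0) (b := 2 * η)
    (fun t _ => hGd t) (hGc'.intervalIntegrable _ _)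
  have hG1 : G (2 * η) = 0 := by
    simp only [hG, hy]
    rw [div_self (by positivity)]; ring
  have hG0 : G 0 = η ^ 12 * ‖w 0‖ ^ 2 := by simp [hG, hy]
  rw [hG1, hG0, zero_sub] at hint
  rw [sub_eq_add_neg _ (η ^ 12 * ‖w 0‖ ^ 2), ← hint, ← intervalIntegral.integral_add
    (Continuous.intervalIntegrable (by fun_prop) _ _) (hGc'.intervalIntegrable _ _)]
  refine intervalIntegral.integral_mono_on (by positivity)
    (Continuous.intervalIntegrable (by fun_prop) _ _)
    (Continuous.intervalIntegrable (by fun_prop) _ _) fun t ht => ?_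
  have hρ0 : 0 ≤ t / (2 * η) := div_nonneg ht.1 (by positivity)
  have hρ1 : t / (2 * η) ≤ 1 := (div_le_one (by positivity)).2 ht.2
  have halg := weight_inequality hK hκ hη hη1 hρ0 hρ1
  have ht' : 2 * η * (t / (2 * η)) = t := by field_simp
  rw [ht'] at halg
  have hJ : 0 ≤ 1 - κ * t := by
    have : κ * t ≤ K * (2 * η) :=
      mul_le_mul (abs_le.1 hκ).2 ht.2 ht.1 (by linarith)
    linarith
  have hsq : 0 ≤ η ^ 16 * ‖w' t‖ ^ 2 + 2 * η ^ 12 * y t * inner ℝ (w t) (w' t) +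
      η ^ 8 * (y t) ^ 2 * ‖w t‖ ^ 2 := by
    have h1 : 0 ≤ ‖(η ^ 8) • w' t + (η ^ 4 * y t) • w t‖ ^ 2 := by positivity
    rw [norm_add_sq_real, norm_smul, norm_smul, inner_smul_left, inner_smul_right,
      mul_pow, mul_pow, Real.norm_eq_abs, Real.norm_eq_abs, sq_abs, sq_abs, real_inner_comm] at h1
    simp only [conj_trivial] at h1
    nlinarith
  have h2 := mul_le_mul_of_nonneg_right halg (sq_nonneg ‖w t‖)
  have h3 := mul_nonneg hJ hsq
  have h4 : η ^ 12 * y' t = -2 * η ^ 11 * (t / (2 * η)) * (1 - (t / (2 * η)) ^ 2) := by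
    simp only [hy']; field_simp
  simp only [hG', h4]
  simp only [hy] at h3 ⊢
  nlinarith

end RobinLaplacian
end

/-! ### Integration in normal coordinates; measurability, bounds and sign of U -/

noncomputable section

namespace RobinLaplacian

theorem eq_coord_smul_add (v : Plane) :
    v = v 0 • EuclideanSpace.single 0 (1 : ℝ) + v 1 • EuclideanSpace.single 1 (1 : ℝ) := by
  ext i; fin_cases i <;> simp

theorem fderiv_apply_eq {F : Type*} [NormedAddCommGroup F] [NormedSpace ℝ F] (φ : Plane → F)
    (x v : Plane) : fderiv ℝ φ x v = v 0 • pderiv 0 φ x + v 1 • pderiv 1 φ x := by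
  conv_lhs => rw [eq_coord_smul_add v]
  rw [map_add, map_smul, map_smul]; rfl

theorem norm_fderiv_apply_sq_le {F : Type*} [NormedAddCommGroup F] [NormedSpace ℝ F]
    (φ : Plane → F) (x v : Plane) :
    ‖fderiv ℝ φ x v‖ ^ 2 ≤ ‖v‖ ^ 2 * ∑ i, ‖pderiv i φ x‖ ^ 2 := by
  have h1 : ‖fderiv ℝ φ x v‖ ≤ |v 0| * ‖pderiv 0 φ x‖ + |v 1| * ‖pderiv 1 φ x‖ := by
    rw [fderiv_apply_eq]
    refine (norm_add_le _ _).trans (le_of_eq ?_)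
    rw [norm_smul, norm_smul, Real.norm_eq_abs, Real.norm_eq_abs]
  refine (pow_le_pow_left₀ (norm_nonneg _) h1 2).trans ?_
  rw [norm_sq_eq, Fin.sum_univ_two, ← sq_abs (v 0), ← sq_abs (v 1)]
  nlinarith [sq_nonneg (|v 0| * ‖pderiv 1 φ x‖ - |v 1| * ‖pderiv 0 φ x‖)]

/-- The identification of the plane with `ℝ × ℝ`. -/
def planeEquiv : Plane ≃ᵐ ℝ × ℝ :=
  (MeasurableEquiv.toLp 2 (Fin 2 → ℝ)).symm.trans MeasurableEquiv.finTwoArrow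

@[simp] theorem planeEquiv_apply (z : Plane) : planeEquiv z = (z 0, z 1) := rfl

theorem measurePreserving_planeEquiv : MeasurePreserving planeEquiv volume volume :=
  (EuclideanSpace.volume_preserving_symm_measurableEquiv_toLp (Fin 2)).trans
    (volume_preserving_finTwoArrow ℝ)

/-- In the standard basis the columns are cT and rot T, so the determinant is c|T|². For c = 1 - κt
this is the Jacobian of the normal coordinates. -/
theorem det_smulRight_add {T : Plane} (hT : ‖T‖ = 1) (c : ℝ) :
    ((EuclideanSpace.proj (0 : Fin 2) : Plane →L[ℝ] ℝ).smulRight (c • T) +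
      (EuclideanSpace.proj (1 : Fin 2) : Plane →L[ℝ] ℝ).smulRight (rot T)).det = c := by
  rw [ContinuousLinearMap.det,
    ← LinearMap.det_toMatrix (EuclideanSpace.basisFun (Fin 2) ℝ).toBasis, Matrix.det_fin_two]
  have h := norm_sq_eq T
  rw [hT] at h
  simp [LinearMap.toMatrix_apply]
  linear_combination -c * h

namespace SmoothBoundary

variable {Ω : Set Plane} {m : ℕ} (B : SmoothBoundary Ω m)

theorem hasFDerivAt_tube (j : Fin m) (z : Plane) :
    HasFDerivAt (fun z : Plane => B.tube j (z 0) (z 1))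
      ((EuclideanSpace.proj (0 : Fin 2) : Plane →L[ℝ] ℝ).smulRight
          ((1 - B.curvature j (z 0) * z 1) • B.tangent j (z 0)) +
        (EuclideanSpace.proj (1 : Fin 2) : Plane →L[ℝ] ℝ).smulRight (B.normal j (z 0))) z := by
  have p0 : HasFDerivAt (fun z : Plane => z 0) (EuclideanSpace.proj (0 : Fin 2) : Plane →L[ℝ] ℝ) z :=
    (EuclideanSpace.proj (0 : Fin 2) : Plane →L[ℝ] ℝ).hasFDerivAt
  have p1 : HasFDerivAt (fun z : Plane => z 1) (EuclideanSpace.proj (1 : Fin 2) : Plane →L[ℝ] ℝ) z :=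
    (EuclideanSpace.proj (1 : Fin 2) : Plane →L[ℝ] ℝ).hasFDerivAt
  have hM := (B.hasDerivAt_M j (z 0)).hasFDerivAt.comp z p0
  have hN := (B.hasDerivAt_normal j (z 0)).hasFDerivAt.comp z p0
  refine (hM.add (p1.smul hN)).congr_fderiv ?_
  ext1 v
  simp only [add_apply, ContinuousLinearMap.comp_apply,
    smul_apply, ContinuousLinearMap.smulRight_apply,
    ContinuousLinearMap.toSpanSingleton_apply, Function.comp]
  module

variable {B} {ε : ℝ}

theorem eq_of_mem_Ioc {L s : ℝ} {n : ℤ} (hL : 0 < L) (h : s ∈ Set.Ioc 0 L)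
    (h' : s + n * L ∈ Set.Ioc 0 L) : s + n * L = s := by
  have h1 : (n : ℝ) < 1 := by
    by_contra hn
    nlinarith [h.1, h'.2, not_lt.1 hn]
  have h2 : (-1 : ℝ) < n := by
    by_contra hn
    nlinarith [h.2, h'.1, not_lt.1 hn]
  have h3 : n = 0 := by
    have h1' : n < 1 := by exact_mod_cast h1
    have h2' : -1 < n := by exact_mod_cast h2
    omega
  simp [h3]

/-- The half-open period removes the ambiguity s ↦ s + nL left by `IsTubeRadius.inj`. -/
theorem IsTubeRadius.injOn (hε : B.IsTubeRadius ε) (j : Fin m) :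
    Set.InjOn (fun z : Plane => B.tube j (z 0) (z 1))
      {z | z 0 ∈ Set.Ioc 0 (B.L j) ∧ z 1 ∈ Set.Ioc 0 ε} := by
  intro z hz z' hz' h
  obtain ⟨-, ⟨n, hn⟩, h1⟩ := hε.inj _ _ _ _ _ _ (by rw [abs_of_pos hz.2.1]; exact hz.2.2)
    (by rw [abs_of_pos hz'.2.1]; exact hz'.2.2) h
  have h2 := hz'.1
  rw [hn] at h2
  have h0 : z' 0 = z 0 := hn.trans (eq_of_mem_Ioc (B.L_pos j) hz.1 h2)
  ext i; fin_cases i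
  · exact h0.symm
  · exact h1

theorem measurableSet_strip {a b : Set ℝ} (ha : MeasurableSet a) (hb : MeasurableSet b) :
    MeasurableSet {z : Plane | z 0 ∈ a ∧ z 1 ∈ b} :=
  planeEquiv.measurable (ha.prod hb)

variable (B) in
/-- The part at distance less than `a` from the boundary of the collar of the `j`-th boundary
curve. -/
def collar (a : ℝ) (j : Fin m) : Set Plane :=
  (fun z : Plane => B.tube j (z 0) (z 1)) ''
    {z | z 0 ∈ Set.Ioc 0 (B.L j) ∧ z 1 ∈ Set.Ioo 0 a}

theorem strip_subset {L a ε : ℝ} (ha : a ≤ ε) : {z : Plane | z 0 ∈ Set.Ioc 0 L ∧ z 1 ∈ Set.Ioo 0 a} ⊆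
    {z : Plane | z 0 ∈ Set.Ioc 0 L ∧ z 1 ∈ Set.Ioc 0 ε} :=
  fun _ hz => ⟨hz.1, hz.2.1, hz.2.2.le.trans ha⟩

theorem IsTubeRadius.measurableSet_collar (hε : B.IsTubeRadius ε) {a : ℝ} (ha : a ≤ ε)
    (j : Fin m) : MeasurableSet (B.collar a j) :=
  measurable_image_of_fderivWithin (measurableSet_strip measurableSet_Ioc measurableSet_Ioo)
    (fun z _ => (B.hasFDerivAt_tube j z).hasFDerivWithinAt) ((hε.injOn j).mono (strip_subset ha))

theorem IsTubeRadius.collar_subset (hε : B.IsTubeRadius ε) {a : ℝ} (ha : a ≤ ε)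
    (j : Fin m) : B.collar a j ⊆ Ω := by
  rintro _ ⟨z, hz, rfl⟩
  exact hε.tube_mem j _ hz.2.1 (hz.2.2.le.trans ha)

theorem IsTubeRadius.pairwise_disjoint_collar (hε : B.IsTubeRadius ε) {a : ℝ} (ha : a ≤ ε) :
    Pairwise (Function.onFun Disjoint (B.collar a)) := by
  intro j k hjk
  refine Set.disjoint_left.2 ?_
  rintro _ ⟨z, hz, rfl⟩ ⟨z', hz', h⟩
  refine hjk (hε.inj _ _ _ _ _ _ ?_ ?_ h).1.symm
  · rw [abs_of_pos hz'.2.1]; exact hz'.2.2.le.trans ha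
  · rw [abs_of_pos hz.2.1]; exact hz.2.2.le.trans ha

/-- Integration in normal coordinates. -/
theorem IsTubeRadius.setIntegral_collar (hε : B.IsTubeRadius ε) {a K : ℝ} (ha : a ≤ ε)
    (hK : ∀ j s, |B.curvature j s| ≤ K) (haK : K * a ≤ 1) (j : Fin m) (f : Plane → ℝ) :
    ∫ x in B.collar a j, f x = ∫ p in Set.Ioc 0 (B.L j) ×ˢ Set.Ioo 0 a,
      (1 - B.curvature j p.1 * p.2) * f (B.tube j p.1 p.2) := by
  rw [collar, integral_image_eq_integral_abs_det_fderiv_smul volume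
    (measurableSet_strip measurableSet_Ioc measurableSet_Ioo)
    (fun z _ => (B.hasFDerivAt_tube j z).hasFDerivWithinAt) ((hε.injOn j).mono (strip_subset ha)),
    ← measurePreserving_planeEquiv.setIntegral_preimage_emb planeEquiv.measurableEmbedding]
  refine setIntegral_congr_fun (measurableSet_strip measurableSet_Ioc measurableSet_Ioo)
    fun z hz => ?_
  rw [normal, tangent, det_smulRight_add (B.unit_speed j (z 0)), abs_of_nonneg, smul_eq_mul]
  · rfl
  · have h1 := (abs_le.1 (hK j (z 0))).2
    have h2 : B.curvature j (z 0) * z 1 ≤ K * a :=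
      mul_le_mul h1 hz.2.2.le hz.2.1.le ((abs_nonneg _).trans (hK j 0))
    linarith

/-- A point of the inner collar is in normal coordinates with arc-length in a period. -/
theorem IsTubeRadius.exists_eq_tube_Ioc (hε : B.IsTubeRadius ε) {x : Plane} (hx : x ∈ Ω)
    (hd : Metric.infDist x (frontier Ω) ≤ ε) :
    ∃ j, ∃ z : Plane, z 0 ∈ Set.Ioc 0 (B.L j) ∧ z 1 ∈ Set.Ioc 0 ε ∧
      z 1 = Metric.infDist x (frontier Ω) ∧ B.tube j (z 0) (z 1) = x := by
  obtain ⟨j, s, t, h0, h1, h2⟩ := hε.exists_eq_tube hx hd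
  obtain ⟨n, hn, -⟩ := existsUnique_add_zsmul_mem_Ioc (B.L_pos j) s 0
  rw [zero_add, zsmul_eq_mul] at hn
  refine ⟨j, !₂[s + n * B.L j, t], hn, ⟨h0, h1.trans_le hd⟩, h1, ?_⟩
  simp only [Matrix.cons_val_zero, Matrix.cons_val_one]
  rw [tube_add_int_mul, h2]

/-- `foot` is a choice function with no measurability of its own. Near the boundary the curvature at
the foot does not depend on the choice, and its level sets are images of measurable sets under the
tube maps, which are differentiable and injective there. The value 0 elsewhere gives a measurable
function on the whole plane. -/
theorem IsTubeRadius.measurable_piecewise_curvature_foot (hε : B.IsTubeRadius ε) {a : ℝ}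
    (ha : a ≤ ε) [∀ x, Decidable (x ∈ {x | x ∈ Ω ∧ Metric.infDist x (frontier Ω) ≤ a})] :
    Measurable ({x | x ∈ Ω ∧ Metric.infDist x (frontier Ω) ≤ a}.piecewise
      (fun x => B.curvature (B.foot x).1 (B.foot x).2) 0) := by
  have hD : MeasurableSet {x | x ∈ Ω ∧ Metric.infDist x (frontier Ω) ≤ a} :=
    B.isOpen.measurableSet.inter (measurableSet_le (Metric.continuous_infDist_pt _).measurable measurable_const)
  intro A hA
  rw [Set.piecewise_preimage]
  refine MeasurableSet.union ?_ ((measurable_const hA).diff hD)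
  have : (fun x => B.curvature (B.foot x).1 (B.foot x).2) ⁻¹' A ∩
      {x | x ∈ Ω ∧ Metric.infDist x (frontier Ω) ≤ a} =
      ⋃ j, (fun z : Plane => B.tube j (z 0) (z 1)) '' ({z | z 0 ∈ Set.Ioc 0 (B.L j) ∩
        B.curvature j ⁻¹' A ∧ z 1 ∈ Set.Ioc 0 ε ∩ Set.Iic a}) := by
    ext x
    simp only [Set.mem_inter_iff, Set.mem_iUnion]
    constructor
    · rintro ⟨h1, h2, h3⟩
      obtain ⟨j, z, hz0, hz1, hz2, rfl⟩ := hε.exists_eq_tube_Ioc h2 (h3.trans ha)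
      refine ⟨j, z, ⟨⟨hz0, ?_⟩, hz1, hz2.trans_le h3⟩, rfl⟩
      have := hε.curvature_foot_tube j (z 0) (t := z 1) (by rw [abs_of_pos hz1.1]; exact hz1.2)
      rw [Set.mem_preimage, this] at h1
      exact h1
    · rintro ⟨j, z, ⟨⟨hz0, hzA⟩, hz1, hza⟩, rfl⟩
      have habs : |z 1| = z 1 := abs_of_pos hz1.1
      refine ⟨?_, hε.tube_mem j _ hz1.1 hz1.2, ?_⟩
      · rw [Set.mem_preimage, hε.curvature_foot_tube j (z 0) (t := z 1) (by rw [habs]; exact hz1.2)]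
        exact hzA
      · rw [hε.infDist_tube j (z 0) (by rw [habs]; exact hz1.2), habs]
        exact hza
  rw [this]
  refine MeasurableSet.iUnion fun j => measurable_image_of_fderivWithin
    (measurableSet_strip (measurableSet_Ioc.inter ((B.continuous_curvature j).measurable hA))
      (measurableSet_Ioc.inter measurableSet_Iic))
    (fun z _ => (B.hasFDerivAt_tube j z).hasFDerivWithinAt) ((hε.injOn j).mono ?_)
  exact fun z hz => ⟨hz.1.1, hz.2.1⟩

/-- Turns the powers 1/8, 3/2 and 7/4 of h = η⁸ into integer powers of η. -/
theorem _root_.RobinLaplacian.pow_eight_rpow {η : ℝ} (hη : 0 < η) {p : ℝ} {n : ℕ}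
    (h : 8 * p = n) : (η ^ 8) ^ p = η ^ n := by
  rw [← Real.rpow_natCast η n, ← h, ← Real.rpow_natCast η 8, ← Real.rpow_mul hη.le]
  norm_num

open Classical in
theorem U_eq {η : ℝ} (hη : 0 < η) (C : ℝ) (x : Plane) :
    B.U C (η ^ 8) x = if Metric.infDist x (frontier Ω) ≤ 2 * η then
      -η ^ 8 - B.curvature (B.foot x).1 (B.foot x).2 * η ^ 12 - C * η ^ 14 else 0 := by
  rw [U, pow_eight_rpow hη (n := 1) (by norm_num), pow_eight_rpow hη (n := 12) (by norm_num),
    pow_eight_rpow hη (n := 14) (by norm_num), pow_one]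

theorem IsTubeRadius.U_tube (hε : B.IsTubeRadius ε) {η : ℝ} (hη : 0 < η) (h : 2 * η ≤ ε) (C : ℝ)
    (j : Fin m) (s : ℝ) {t : ℝ} (ht : t ∈ Set.Ioo 0 (2 * η)) :
    B.U C (η ^ 8) (B.tube j s t) = -η ^ 8 - B.curvature j s * η ^ 12 - C * η ^ 14 := by
  have habs : |t| ≤ ε := by rw [abs_of_pos ht.1]; exact ht.2.le.trans h
  rw [U_eq hη, hε.infDist_tube j s habs, hε.curvature_foot_tube j s habs, abs_of_pos ht.1,
    if_pos ht.2.le]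

theorem IsTubeRadius.aestronglyMeasurable_U (hε : B.IsTubeRadius ε) {η : ℝ} (hη : 0 < η)
    (h : 2 * η ≤ ε) (C : ℝ) :
    AEStronglyMeasurable (B.U C (η ^ 8)) (volume.restrict Ω) := by
  classical
  have hV := hε.measurable_piecewise_curvature_foot h
  have hm : Measurable fun x => if Metric.infDist x (frontier Ω) ≤ 2 * η then
      -η ^ 8 - ({x | x ∈ Ω ∧ Metric.infDist x (frontier Ω) ≤ 2 * η}.piecewise
      (fun x => B.curvature (B.foot x).1 (B.foot x).2) 0) x * η ^ 12 - C * η ^ 14 else 0 :=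
    Measurable.ite (measurableSet_le (Metric.continuous_infDist_pt _).measurable measurable_const)
      (((hV.mul_const _).const_sub _).sub_const _) measurable_const
  refine hm.aestronglyMeasurable.congr ?_
  refine (ae_restrict_iff' B.isOpen.measurableSet).2 (Eventually.of_forall fun x hx => ?_)
  simp only
  rw [U_eq hη]
  by_cases hd : Metric.infDist x (frontier Ω) ≤ 2 * η
  · rw [if_pos hd, if_pos hd, Set.piecewise_eq_of_mem {x | x ∈ Ω ∧ Metric.infDist x (frontier Ω) ≤ 2 * η} _ _ ⟨hx, hd⟩]
  · rw [if_neg hd, if_neg hd]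

theorem abs_U_le {K η C : ℝ} (hK : ∀ j s, |B.curvature j s| ≤ K) (hη : 0 < η) (hC : 0 ≤ C)
    (x : Plane) : |B.U C (η ^ 8) x| ≤ η ^ 8 + K * η ^ 12 + C * η ^ 14 := by
  rw [U_eq hη]
  have hK0 := (abs_nonneg _).trans (hK (B.foot x).1 (B.foot x).2)
  have hk := abs_le.1 (hK (B.foot x).1 (B.foot x).2)
  have h12 : 0 < η ^ 12 := by positivity
  have h8 : 0 < η ^ 8 := by positivity
  have h14 : 0 ≤ C * η ^ 14 := by positivity
  split_ifs
  · rw [abs_le]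
    constructor <;> nlinarith
  · rw [abs_zero]; positivity

/-- For small η the curvature term is dominated by -η⁸. The sign allows the part of Ω outside the
collars to be discarded. -/
theorem U_nonpos {K η C : ℝ} (hK : ∀ j s, |B.curvature j s| ≤ K) (hη : 0 < η) (hC : 0 ≤ C)
    (hη1 : K * η ^ 4 ≤ 1) (x : Plane) : B.U C (η ^ 8) x ≤ 0 := by
  rw [U_eq hη]
  have hk := abs_le.1 (hK (B.foot x).1 (B.foot x).2)
  have h12 : 0 < η ^ 12 := by positivity
  have h8 : 0 < η ^ 8 := by positivity
  have h14 : 0 ≤ C * η ^ 14 := by positivity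
  split_ifs
  · have h1 : η ^ 8 * (K * η ^ 4) ≤ η ^ 8 * 1 := mul_le_mul_of_nonneg_left hη1 h8.le
    have h2 : η ^ 12 = η ^ 8 * η ^ 4 := by ring
    nlinarith
  · exact le_rfl

end SmoothBoundary
end RobinLaplacian
end

/-! ### The lower bound for smooth functions -/

noncomputable section

namespace RobinLaplacian

theorem contDiff_pderiv {F : Type*} [NormedAddCommGroup F] [NormedSpace ℝ F] {φ : Plane → F}
    (hφ : ContDiff ℝ ∞ φ) (i : Fin 2) : ContDiff ℝ ∞ (pderiv i φ) :=
  (hφ.fderiv_right (m := ∞) (by simp)).clm_apply contDiff_const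

theorem hasCompactSupport_pderiv {F : Type*} [NormedAddCommGroup F] [NormedSpace ℝ F]
    {φ : Plane → F} (hφ : HasCompactSupport φ) (i : Fin 2) : HasCompactSupport (pderiv i φ) :=
  hφ.fderiv_apply (𝕜 := ℝ) _

namespace SmoothBoundary

variable {Ω : Set Plane} {m : ℕ} {B : SmoothBoundary Ω m} {ε : ℝ}

variable (B) in
theorem arcLength_integral {f : Plane → ℝ} (hf : Continuous f) :
    ∫ x, f x ∂B.arcLength = ∑ j, ∫ s in Set.Ioc 0 (B.L j), f (B.M j s) := by
  have hM : ∀ j, Continuous (B.M j) := fun j => (B.smooth j).continuous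
  rw [arcLength, integral_finsetSum_measure]
  · refine Finset.sum_congr rfl fun j _ => ?_
    rw [integral_map (hM j).aemeasurable hf.aestronglyMeasurable]
  · intro j _
    rw [integrable_map_measure hf.aestronglyMeasurable (hM j).aemeasurable]
    exact ((hf.comp (hM j)).continuousOn.integrableOn_Icc).mono_set Set.Ioc_subset_Icc_self

theorem integrableOn_strip {L a : ℝ} {f : ℝ × ℝ → ℝ} (hf : Continuous f) :
    IntegrableOn f (Set.Ioc 0 L ×ˢ Set.Ioo 0 a) (volume.prod volume) :=
  (hf.continuousOn.integrableOn_compact (isCompact_Icc.prod isCompact_Icc)).mono_set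
    (Set.prod_mono Set.Ioc_subset_Icc_self Set.Ioo_subset_Icc_self)

theorem continuous_tube_right (j : Fin m) (s : ℝ) : Continuous fun t => B.tube j s t :=
  (B.continuous_tube j).comp (continuous_const.prodMk continuous_id)

/-- The lower bound on one collar. -/
theorem IsTubeRadius.collar_inequality (hε : B.IsTubeRadius ε) {K η : ℝ} (hK1 : 1 ≤ K)
    (hK : ∀ j s, |B.curvature j s| ≤ K) (hη : 0 < η) (hηε : 2 * η ≤ ε) (hηK : 16 * K * η ≤ 1)
    {φ : Plane → ℂ} (hφ : ContDiff ℝ ∞ φ) (j : Fin m) :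
    ∫ x in B.collar (2 * η) j, B.U (lowerConst K) (η ^ 8) x * ‖φ x‖ ^ 2 ≤
      (∫ x in B.collar (2 * η) j, η ^ 16 * ∑ i, ‖pderiv i φ x‖ ^ 2) -
        η ^ 12 * ∫ s in Set.Ioc 0 (B.L j), ‖φ (B.M j s)‖ ^ 2 := by
  have ha : K * (2 * η) ≤ 1 := by linarith
  have hκc := B.continuous_curvature j
  have hMc : Continuous (B.M j) := (B.smooth j).continuous
  have htc := B.continuous_tube j
  have hφc := hφ.continuous
  have hφ' : ∀ i, Continuous (pderiv i φ) := fun i => (contDiff_pderiv hφ i).continuous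
  set c : ℝ → ℝ := fun s => -η ^ 8 - B.curvature j s * η ^ 12 - lowerConst K * η ^ 14 with hc
  -- On the collar U depends on s only, so Fubini leaves a constant potential on each normal
  -- segment.
  have e1 : ∫ x in B.collar (2 * η) j, B.U (lowerConst K) (η ^ 8) x * ‖φ x‖ ^ 2 =
      ∫ s in Set.Ioc 0 (B.L j), ∫ t in (0 : ℝ)..(2 * η),
        (1 - B.curvature j s * t) * (c s * ‖φ (B.tube j s t)‖ ^ 2) := by
    rw [hε.setIntegral_collar hηε hK ha j]
    have : ∫ p in Set.Ioc 0 (B.L j) ×ˢ Set.Ioo 0 (2 * η), (1 - B.curvature j p.1 * p.2) *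
        (B.U (lowerConst K) (η ^ 8) (B.tube j p.1 p.2) * ‖φ (B.tube j p.1 p.2)‖ ^ 2) =
        ∫ p in Set.Ioc 0 (B.L j) ×ˢ Set.Ioo 0 (2 * η), (1 - B.curvature j p.1 * p.2) *
        (c p.1 * ‖φ (B.tube j p.1 p.2)‖ ^ 2) := by
      refine setIntegral_congr_fun (measurableSet_Ioc.prod measurableSet_Ioo) fun p hp => ?_
      rw [hε.U_tube hη hηε _ j p.1 hp.2]
    rw [this, Measure.volume_eq_prod, setIntegral_prod _ (integrableOn_strip (by fun_prop))]
    refine integral_congr_ae (Eventually.of_forall fun s => ?_)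
    simp only
    rw [intervalIntegral.integral_of_le (by positivity), integral_Ioc_eq_integral_Ioo]
  have e2 : ∫ x in B.collar (2 * η) j, η ^ 16 * ∑ i, ‖pderiv i φ x‖ ^ 2 =
      ∫ s in Set.Ioc 0 (B.L j), ∫ t in (0 : ℝ)..(2 * η),
        (1 - B.curvature j s * t) * (η ^ 16 * ∑ i, ‖pderiv i φ (B.tube j s t)‖ ^ 2) := by
    rw [hε.setIntegral_collar hηε hK ha j, Measure.volume_eq_prod,
      setIntegral_prod _ (integrableOn_strip (by fun_prop))]
    refine integral_congr_ae (Eventually.of_forall fun s => ?_)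
    simp only
    rw [intervalIntegral.integral_of_le (by positivity), integral_Ioc_eq_integral_Ioo]
  have icont : ∀ {f : ℝ → ℝ}, Continuous f → IntegrableOn f (Set.Ioc 0 (B.L j)) := fun hf =>
    hf.continuousOn.integrableOn_Icc.mono_set Set.Ioc_subset_Icc_self
  have hcont1 : Continuous fun s => ∫ t in (0 : ℝ)..(2 * η),
      (1 - B.curvature j s * t) * (c s * ‖φ (B.tube j s t)‖ ^ 2) :=
    intervalIntegral.continuous_parametric_intervalIntegral_of_continuous' (by fun_prop) _ _
  have hcont2 : Continuous fun s => ∫ t in (0 : ℝ)..(2 * η),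
      (1 - B.curvature j s * t) * (η ^ 16 * ∑ i, ‖pderiv i φ (B.tube j s t)‖ ^ 2) :=
    intervalIntegral.continuous_parametric_intervalIntegral_of_continuous' (by fun_prop) _ _
  have hcont3 : Continuous fun s => η ^ 12 * ‖φ (B.M j s)‖ ^ 2 := by fun_prop
  rw [e1, e2, ← integral_const_mul, ← integral_sub (icont hcont2) (icont hcont3)]
  -- For fixed s the segment inequality applies to φ along the normal; the normal derivative is then
  -- bounded by the full gradient.
  refine setIntegral_mono (icont hcont1) (icont (hcont2.sub hcont3)) fun s => ?_
  have htd : ∀ t, HasDerivAt (fun t => B.tube j s t) (B.normal j s) t := fun t => by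
    simpa [tube] using ((hasDerivAt_id t).smul_const (B.normal j s)).const_add (B.M j s)
  have hwd : ∀ t, HasDerivAt (fun t => φ (B.tube j s t))
      (fderiv ℝ φ (B.tube j s t) (B.normal j s)) t := fun t =>
    ((hφ.differentiable (by simp)) _).hasFDerivAt.comp_hasDerivAt t (htd t)
  have htcs : Continuous fun t => B.tube j s t := continuous_tube_right j s
  have hwc : Continuous fun t => fderiv ℝ φ (B.tube j s t) (B.normal j s) :=
    (((hφ.continuous_fderiv (by simp)).comp htcs).clm_apply continuous_const)
  refine (segment_inequality hK1 (hK j s) hη hηK hwd hwc).trans ?_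
  have h0 : B.tube j s 0 = B.M j s := by simp [tube]
  simp only [h0]
  refine sub_le_sub_right ?_ _
  refine intervalIntegral.integral_mono_on (by positivity)
    (Continuous.intervalIntegrable (by fun_prop) _ _)
    (Continuous.intervalIntegrable (by fun_prop) _ _) fun t ht => ?_
  have hJ : 0 ≤ 1 - B.curvature j s * t := by
    have : B.curvature j s * t ≤ K * (2 * η) :=
      mul_le_mul (abs_le.1 (hK j s)).2 ht.2 ht.1 (by linarith)
    linarith
  refine mul_le_mul_of_nonneg_left (mul_le_mul_of_nonneg_left ?_ (by positivity)) hJ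
  have := norm_fderiv_apply_sq_le φ (B.tube j s t) (B.normal j s)
  rwa [norm_normal, one_pow, one_mul] at this

theorem integrable_normSq {φ : Plane → ℂ} (hφ : Continuous φ) (hc : HasCompactSupport φ) :
    Integrable (fun x => ‖φ x‖ ^ 2) := by
  refine Continuous.integrable_of_hasCompactSupport (by fun_prop) ?_
  exact hc.comp_left (g := fun z : ℂ => ‖z‖ ^ 2) (by simp)

theorem IsTubeRadius.integrableOn_U_mul (hε : B.IsTubeRadius ε) {K η C : ℝ}
    (hK : ∀ j s, |B.curvature j s| ≤ K) (hη : 0 < η) (hηε : 2 * η ≤ ε) (hC : 0 ≤ C)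
    {f : Plane → ℝ} (hf : IntegrableOn f Ω) :
    IntegrableOn (fun x => B.U C (η ^ 8) x * f x) Ω :=
  hf.bdd_mul (hε.aestronglyMeasurable_U hη hηε C)
    (Eventually.of_forall fun x => (Real.norm_eq_abs _).trans_le (abs_U_le hK hη hC x))

/-- The lower bound for smooth functions. -/
theorem IsTubeRadius.lower_bound_smooth (hε : B.IsTubeRadius ε) {K η : ℝ} (hK1 : 1 ≤ K)
    (hK : ∀ j s, |B.curvature j s| ≤ K) (hη : 0 < η) (hηε : 2 * η ≤ ε) (hηK : 16 * K * η ≤ 1)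
    {φ : Plane → ℂ} (hφ : ContDiff ℝ ∞ φ) (hcs : HasCompactSupport φ) :
    ∫ x in Ω, B.U (lowerConst K) (η ^ 8) x * ‖φ x‖ ^ 2 ≤
      quadForm B (η ^ 8) (fun i => pderiv i φ) φ := by
  have hCpos : 0 ≤ lowerConst K := by rw [lowerConst]; positivity
  have hη1 : η ≤ 1 := by nlinarith
  have hKη : K * η ^ 4 ≤ 1 := by
    have : η ^ 4 ≤ η := by
      have : η ^ 3 ≤ 1 := pow_le_one₀ hη.le hη1
      nlinarith
    nlinarith
  have hUint : IntegrableOn (fun x => B.U (lowerConst K) (η ^ 8) x * ‖φ x‖ ^ 2) Ω :=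
    hε.integrableOn_U_mul hK hη hηε hCpos (integrable_normSq hφ.continuous hcs).integrableOn
  have hGint : Integrable (fun x => η ^ 16 * ∑ i, ‖pderiv i φ x‖ ^ 2) :=
    (integrable_finsetSum _ fun i _ => integrable_normSq (contDiff_pderiv hφ i).continuous
      (hasCompactSupport_pderiv hcs i)).const_mul _
  have hsub : (⋃ j, B.collar (2 * η) j) ⊆ Ω := Set.iUnion_subset fun j => hε.collar_subset hηε j
  have hmeas := fun j => hε.measurableSet_collar hηε j
  have hdisj := hε.pairwise_disjoint_collar hηε
  -- Since U ≤ 0, restricting to the collars can only increase the integral; points at distance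
  -- exactly 2η need no separate treatment.
  have h1 : ∫ x in Ω, B.U (lowerConst K) (η ^ 8) x * ‖φ x‖ ^ 2 ≤
      ∫ x in ⋃ j, B.collar (2 * η) j, B.U (lowerConst K) (η ^ 8) x * ‖φ x‖ ^ 2 := by
    have := setIntegral_mono_set hUint.neg (Eventually.of_forall fun x => by
      simpa using mul_nonpos_of_nonpos_of_nonneg (U_nonpos (B := B) hK hη hCpos hKη x)
        (sq_nonneg ‖φ x‖)) hsub.eventuallyLE
    simp only [Pi.neg_apply, integral_neg] at this
    linarith
  have h2 : ∫ x in ⋃ j, B.collar (2 * η) j, η ^ 16 * ∑ i, ‖pderiv i φ x‖ ^ 2 ≤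
      ∫ x in Ω, η ^ 16 * ∑ i, ‖pderiv i φ x‖ ^ 2 :=
    setIntegral_mono_set hGint.integrableOn (Eventually.of_forall fun x => by
      simp only [Pi.zero_apply]; positivity) hsub.eventuallyLE
  have h3 : (∫ x in Ω, ∑ i, ‖((η ^ 8 : ℝ) : ℂ) * pderiv i φ x‖ ^ 2) =
      ∫ x in Ω, η ^ 16 * ∑ i, ‖pderiv i φ x‖ ^ 2 := by
    refine integral_congr_ae (Eventually.of_forall fun x => ?_)
    simp only [Finset.mul_sum]
    refine Finset.sum_congr rfl fun i _ => ?_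
    rw [norm_mul, mul_pow, Complex.norm_real, Real.norm_of_nonneg (by positivity)]
    ring
  rw [integral_iUnion_fintype hmeas hdisj fun j =>
    hUint.mono_set (hε.collar_subset hηε j)] at h1
  rw [integral_iUnion_fintype hmeas hdisj fun j => hGint.integrableOn] at h2
  have h4 : Continuous fun x => ‖φ x‖ ^ 2 := by
    have := hφ.continuous
    fun_prop
  rw [quadForm, h3, pow_eight_rpow hη (n := 12) (by norm_num), arcLength_integral B h4]
  have h5 := Finset.sum_le_sum fun j (_ : j ∈ Finset.univ) =>
    hε.collar_inequality hK1 hK hη hηε hηK hφ j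
  rw [Finset.sum_sub_distrib, ← Finset.mul_sum] at h5
  linarith

end SmoothBoundary
end RobinLaplacian
end

/-! ### Passage to the limit in H¹, trace inequality and existence of traces -/

noncomputable section

namespace RobinLaplacian

theorem integral_norm_sq_eq {α E : Type*} [MeasurableSpace α] [NormedAddCommGroup E]
    {μ : Measure α} {f : α → E} (hf : MemLp f 2 μ) :
    ∫ x, ‖f x‖ ^ 2 ∂μ = (eLpNorm f 2 μ).toReal ^ 2 := by
  have h0 : 0 ≤ ∫ x, ‖f x‖ ^ (2 : ℝ) ∂μ := integral_nonneg fun x => by positivity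
  rw [hf.eLpNorm_eq_integral_rpow_norm (by simp) (by simp), ENNReal.toReal_ofReal (by positivity)]
  simp only [ENNReal.toReal_ofNat]
  rw [← Real.rpow_natCast, ← Real.rpow_mul h0]
  norm_num

/-- Weighted quadratic integrals are continuous for `L²` convergence. -/
theorem tendsto_integral_mul_norm_sq {α : Type*} [MeasurableSpace α] {μ : Measure α} {c : ℝ}
    {w : α → ℝ} (hw : AEStronglyMeasurable w μ) (hwc : ∀ x, |w x| ≤ c) {f : ℕ → α → ℂ}
    {g : α → ℂ} (hf : ∀ n, MemLp (f n) 2 μ) (hg : MemLp g 2 μ)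
    (h : Tendsto (fun n => eLpNorm (f n - g) 2 μ) atTop (𝓝 0)) :
    Tendsto (fun n => ∫ x, w x * ‖f n x‖ ^ 2 ∂μ) atTop (𝓝 (∫ x, w x * ‖g x‖ ^ 2 ∂μ)) := by
  have hsq : ∀ {u : α → ℂ}, MemLp u 2 μ → Integrable (fun x => ‖u x‖ ^ 2) μ := fun hu =>
    (memLp_two_iff_integrable_sq_norm hu.1).1 hu
  refine tendsto_integral_of_L1' _ (hw.mul (hsq hg).1) (Eventually.of_forall fun n =>
    (hsq (hf n)).bdd_mul hw (Eventually.of_forall hwc)) ?_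
  -- This majorant comes from Hölder's inequality and ||f|² - |g|²| ≤ |f - g| (|f - g| + 2|g|).
  have hlim : Tendsto (fun n => eLpNorm (f n - g) 2 μ *
      (‖c‖ₑ * (eLpNorm (f n - g) 2 μ + eLpNorm g 2 μ + eLpNorm g 2 μ))) atTop (𝓝 0) := by
    have h1 := (h.add_const (eLpNorm g 2 μ)).add_const (eLpNorm g 2 μ)
    have h2 := ENNReal.Tendsto.const_mul (a := ‖c‖ₑ) h1 (Or.inr (by simp))
    have h3 := ENNReal.Tendsto.mul h (Or.inr (ENNReal.mul_ne_top (by simp)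
      (ENNReal.add_ne_top.2 ⟨ENNReal.add_ne_top.2 ⟨by simp, hg.2.ne⟩, hg.2.ne⟩))) h2
      (Or.inr (by simp))
    rwa [zero_mul] at h3
  refine tendsto_of_tendsto_of_tendsto_of_le_of_le tendsto_const_nhds hlim (fun _ => zero_le) ?_
  intro n
  have hd : MemLp (f n - g) 2 μ := (hf n).sub hg
  have e1 : eLpNorm ((fun x => w x * ‖f n x‖ ^ 2) - fun x => w x * ‖g x‖ ^ 2) 1 μ ≤
      eLpNorm ((fun x => ‖(f n - g) x‖) • (c • fun x => ‖(f n - g) x‖ + ‖g x‖ + ‖g x‖)) 1 μ := by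
    refine eLpNorm_mono_real fun x => ?_
    simp only [Pi.sub_apply, Pi.smul_apply', smul_eq_mul, Real.norm_eq_abs, Pi.smul_apply]
    have a1 : |‖f n x‖ - ‖g x‖| ≤ ‖f n x - g x‖ := abs_norm_sub_norm_le _ _
    have a2 : ‖f n x‖ ≤ ‖f n x - g x‖ + ‖g x‖ := by
      simpa using norm_add_le (f n x - g x) (g x)
    have a3 : w x * ‖f n x‖ ^ 2 - w x * ‖g x‖ ^ 2 =
      w x * ((‖f n x‖ - ‖g x‖) * (‖f n x‖ + ‖g x‖)) := by ring
    have hc := (abs_nonneg _).trans (hwc x)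
    rw [a3, abs_mul, abs_mul, abs_of_nonneg (show 0 ≤ ‖f n x‖ + ‖g x‖ by positivity)]
    calc _ ≤ c * (‖f n x - g x‖ * (‖f n x - g x‖ + ‖g x‖ + ‖g x‖)) :=
          mul_le_mul (hwc x) (mul_le_mul a1 (by linarith) (by positivity) (by positivity))
            (by positivity) hc
      _ = _ := by ring
  refine e1.trans ?_
  refine (eLpNorm_smul_le_mul_eLpNorm (p := 2) (q := 2) (((hd.1.norm.add hg.1.norm).add
    hg.1.norm).const_smul c) hd.1.norm).trans ?_
  rw [eLpNorm_norm, eLpNorm_const_smul]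
  refine mul_le_mul' le_rfl (mul_le_mul' le_rfl ?_)
  have e2 := eLpNorm_add_le (hd.1.norm.add hg.1.norm) hg.1.norm (p := 2) (by norm_num)
  have e3 := eLpNorm_add_le hd.1.norm hg.1.norm (p := 2) (by norm_num)
  rw [eLpNorm_norm, eLpNorm_norm] at e3
  rw [eLpNorm_norm] at e2
  exact e2.trans (add_le_add_left e3 _)

theorem memLp_of_smooth {F : Type*} [NormedAddCommGroup F] [NormedSpace ℝ F] {φ : Plane → F}
    (hφ : Continuous φ) (hc : HasCompactSupport φ) (μ : Measure Plane)
    [IsFiniteMeasureOnCompacts μ] : MemLp φ 2 μ :=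
  hφ.memLp_of_hasCompactSupport hc

namespace SmoothBoundary

variable {Ω : Set Plane} {m : ℕ} (B : SmoothBoundary Ω m) {ε : ℝ}

instance : IsFiniteMeasure B.arcLength := by
  constructor
  rw [arcLength, Measure.finsetSum_apply]
  refine ENNReal.sum_lt_top.2 fun j _ => ?_
  rw [Measure.map_apply (B.smooth j).continuous.measurable MeasurableSet.univ]
  simp

/-- Every term, including the boundary one with its weight 1, gets the shape required by
`tendsto_integral_mul_norm_sq`. -/
theorem quadForm_eq {h : ℝ} {g : Fin 2 → Plane → ℂ} (hg : ∀ i, MemLp (g i) 2 (volume.restrict Ω))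
    (τ : Plane → ℂ) : quadForm B h g τ = (∑ i, ∫ x in Ω, h ^ 2 * ‖g i x‖ ^ 2) -
      h ^ (3 / 2 : ℝ) * ∫ x, 1 * ‖τ x‖ ^ 2 ∂B.arcLength := by
  rw [quadForm, ← integral_finsetSum]
  · simp [mul_pow]
  · exact fun i _ => ((memLp_two_iff_integrable_sq_norm (hg i).1).1 (hg i)).const_mul _

variable {B}

/-- U is bounded, so both sides are continuous along the approximating sequence supplied by the
trace, and the smooth inequality passes to the limit. -/
theorem IsTubeRadius.lower_bound (hε : B.IsTubeRadius ε) {K η : ℝ} (hK1 : 1 ≤ K)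
    (hK : ∀ j s, |B.curvature j s| ≤ K) (hη : 0 < η) (hηε : 2 * η ≤ ε) (hηK : 16 * K * η ≤ 1)
    {u : Plane → ℂ} {g : Fin 2 → Plane → ℂ} {τ : Plane → ℂ} (hu : IsH1 Ω u g)
    (hτ : IsTrace B u g τ) :
    ∫ x in Ω, B.U (lowerConst K) (η ^ 8) x * ‖u x‖ ^ 2 ≤ quadForm B (η ^ 8) g τ := by
  have hCpos : 0 ≤ lowerConst K := by rw [lowerConst]; positivity
  obtain ⟨φ, hφ, l1, l2, l3⟩ := hτ.approx
  have m1 : ∀ n, MemLp (φ n) 2 (volume.restrict Ω) := fun n =>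
    memLp_of_smooth (hφ n).1.continuous (hφ n).2 _
  have m2 : ∀ n i, MemLp (pderiv i (φ n)) 2 (volume.restrict Ω) := fun n i =>
    memLp_of_smooth (contDiff_pderiv (hφ n).1 i).continuous (hasCompactSupport_pderiv (hφ n).2 i) _
  have m3 : ∀ n, MemLp (φ n) 2 B.arcLength := fun n =>
    memLp_of_smooth (hφ n).1.continuous (hφ n).2 _
  have t1 := tendsto_integral_mul_norm_sq (hε.aestronglyMeasurable_U hη hηε (lowerConst K))
    (fun x => abs_U_le hK hη hCpos x) m1 hu.memLp l1
  have t2 : ∀ i, _ := fun i => tendsto_integral_mul_norm_sq (μ := volume.restrict Ω)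
    (w := fun _ => (η ^ 8) ^ 2) aestronglyMeasurable_const (fun x => le_rfl)
    (fun n => m2 n i) (hu.memLp_grad i) (l2 i)
  have t3 := tendsto_integral_mul_norm_sq (μ := B.arcLength)
    (w := fun _ => 1) aestronglyMeasurable_const (fun x => le_rfl) m3 hτ.memLp l3
  refine le_of_tendsto_of_tendsto' t1 (b := atTop) (g := fun n =>
    quadForm B (η ^ 8) (fun i => pderiv i (φ n)) (φ n)) ?_ fun n =>
    hε.lower_bound_smooth hK1 hK hη hηε hηK (hφ n).1 (hφ n).2
  rw [quadForm_eq B hu.memLp_grad]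
  have : (fun n => quadForm B (η ^ 8) (fun i => pderiv i (φ n)) (φ n)) = fun n =>
      (∑ i, ∫ x in Ω, (η ^ 8) ^ 2 * ‖pderiv i (φ n) x‖ ^ 2) -
      (η ^ 8) ^ (3 / 2 : ℝ) * ∫ x, 1 * ‖φ n x‖ ^ 2 ∂B.arcLength :=
    funext fun n => quadForm_eq B (m2 n) _
  rw [this]
  exact (tendsto_finsetSum _ fun i _ => t2 i).sub (t3.const_mul _)

variable (B)

/-- The trace inequality for smooth functions. -/
theorem exists_trace_inequality : ∃ A : ℝ, 0 < A ∧ ∀ φ : Plane → ℂ, ContDiff ℝ ∞ φ →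
    HasCompactSupport φ → ∫ x, ‖φ x‖ ^ 2 ∂B.arcLength ≤
      A * ((∑ i, ∫ x in Ω, ‖pderiv i φ x‖ ^ 2) + ∫ x in Ω, ‖φ x‖ ^ 2) := by
  obtain ⟨ε, hε⟩ := B.exists_isTubeRadius
  obtain ⟨K, hK1, hK⟩ := B.exists_curvature_bound
  have hεpos := hε.pos
  -- One admissible η is fixed. As U ≥ -c, the smooth lower bound reads η¹²∫|φ|² ds ≤ η¹⁶∫|∇φ|² +
  -- c∫|φ|².
  set η := min (ε / 2) (1 / (16 * K)) with hηdef
  have hη : 0 < η := by positivity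
  have hηε : 2 * η ≤ ε := by linarith [min_le_left (ε / 2) (1 / (16 * K))]
  have hηK : 16 * K * η ≤ 1 := by
    have := mul_le_mul_of_nonneg_left (min_le_right (ε / 2) (1 / (16 * K)))
      (show 0 ≤ 16 * K by positivity)
    rwa [show 16 * K * (1 / (16 * K)) = 1 by field_simp] at this
  have hCpos : 0 ≤ lowerConst K := by rw [lowerConst]; positivity
  set c := η ^ 8 + K * η ^ 12 + lowerConst K * η ^ 14 with hc
  have hcpos : 0 < c := by positivity
  refine ⟨(η ^ 16 + c) / η ^ 12, by positivity, fun φ hφ hcs => ?_⟩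
  have h1 := hε.lower_bound_smooth hK1 hK hη hηε hηK hφ hcs
  rw [quadForm_eq B (fun i => memLp_of_smooth (contDiff_pderiv hφ i).continuous
    (hasCompactSupport_pderiv hcs i) _), pow_eight_rpow hη (n := 12) (by norm_num)] at h1
  simp only [one_mul, integral_const_mul, ← Finset.mul_sum] at h1
  have hi := (integrable_normSq hφ.continuous hcs).integrableOn (s := Ω)
  have h2 : -(c * ∫ x in Ω, ‖φ x‖ ^ 2) ≤
      ∫ x in Ω, B.U (lowerConst K) (η ^ 8) x * ‖φ x‖ ^ 2 := by
    rw [← integral_const_mul, ← integral_neg]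
    refine integral_mono (hi.const_mul c).neg (hε.integrableOn_U_mul hK hη hηε hCpos hi)
      fun x => ?_
    have := (abs_le.1 (abs_U_le (B := B) hK hη hCpos x)).1
    simp only [← hc] at this
    nlinarith [sq_nonneg ‖φ x‖]
  rw [div_mul_eq_mul_div, le_div_iff₀ (by positivity)]
  have h3 : 0 ≤ ∫ x in Ω, ‖φ x‖ ^ 2 := integral_nonneg fun x => sq_nonneg _
  have h4 : 0 ≤ ∑ i, ∫ x in Ω, ‖pderiv i φ x‖ ^ 2 :=
    Finset.sum_nonneg fun i _ => integral_nonneg fun x => sq_nonneg _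
  have h5 : 0 < η ^ 16 := by positivity
  nlinarith [mul_nonneg hcpos.le h4, mul_nonneg h5.le h3]

theorem _root_.RobinLaplacian.pderiv_sub {φ ψ : Plane → ℂ} (hφ : ContDiff ℝ ∞ φ)
    (hψ : ContDiff ℝ ∞ ψ) (i : Fin 2) : pderiv i (φ - ψ) = pderiv i φ - pderiv i ψ := by
  ext x
  simp only [pderiv, Pi.sub_apply]
  rw [fderiv_sub (hφ.differentiable (by simp) x) (hψ.differentiable (by simp) x)]
  rfl

/-- A trace exists as soon as there are smooth approximations in `H¹`. -/
theorem exists_isTrace_of_approx {u : Plane → ℂ} {g : Fin 2 → Plane → ℂ} (hu : IsH1 Ω u g)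
    (h : ∀ δ : ℝ, 0 < δ → ∃ φ : Plane → ℂ, ContDiff ℝ ∞ φ ∧ HasCompactSupport φ ∧
      eLpNorm (φ - u) 2 (volume.restrict Ω) ≤ ENNReal.ofReal δ ∧
      ∀ i, eLpNorm (pderiv i φ - g i) 2 (volume.restrict Ω) ≤ ENNReal.ofReal δ) :
    ∃ τ, IsTrace B u g τ := by
  obtain ⟨A, hA, htr⟩ := B.exists_trace_inequality
  choose φ hφ hcs hφu hφg using fun n : ℕ => h (1 / ((n : ℝ) + 1)) (by positivity)
  have m1 : ∀ n, MemLp (φ n) 2 (volume.restrict Ω) := fun n =>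
    memLp_of_smooth (hφ n).continuous (hcs n) _
  have m2 : ∀ n i, MemLp (pderiv i (φ n)) 2 (volume.restrict Ω) := fun n i =>
    memLp_of_smooth (contDiff_pderiv (hφ n) i).continuous (hasCompactSupport_pderiv (hcs n) i) _
  have m3 : ∀ n, MemLp (φ n) 2 B.arcLength := fun n =>
    memLp_of_smooth (hφ n).continuous (hcs n) _
  have hlim0 : Tendsto (fun n : ℕ => 1 / ((n : ℝ) + 1)) atTop (𝓝 0) :=
    tendsto_one_div_add_atTop_nhds_zero_nat
  have hlim : Tendsto (fun n : ℕ => ENNReal.ofReal (1 / ((n : ℝ) + 1))) atTop (𝓝 0) := by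
    simpa using ENNReal.tendsto_ofReal hlim0
  -- Triangle inequality through the common limit f, used for the functions and for each partial
  -- derivative.
  have key : ∀ {f₁ f₂ f : Plane → ℂ} {n p N : ℕ}, N ≤ n → N ≤ p →
      MemLp f₁ 2 (volume.restrict Ω) → MemLp f₂ 2 (volume.restrict Ω) →
      MemLp f 2 (volume.restrict Ω) →
      eLpNorm (f₁ - f) 2 (volume.restrict Ω) ≤ ENNReal.ofReal (1 / ((n : ℝ) + 1)) →
      eLpNorm (f₂ - f) 2 (volume.restrict Ω) ≤ ENNReal.ofReal (1 / ((p : ℝ) + 1)) →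
      ∫ x in Ω, ‖(f₁ - f₂) x‖ ^ 2 ≤ (2 * (1 / ((N : ℝ) + 1))) ^ 2 := by
    intro f₁ f₂ f n p N hn hp h₁ h₂ hf e₁ e₂
    rw [integral_norm_sq_eq (h₁.sub h₂)]
    refine pow_le_pow_left₀ ENNReal.toReal_nonneg ?_ 2
    refine ENNReal.toReal_le_of_le_ofReal (by positivity) ?_
    have e3 : f₁ - f₂ = (f₁ - f) - (f₂ - f) := by abel
    rw [e3, two_mul, ENNReal.ofReal_add (by positivity) (by positivity)]
    refine (eLpNorm_sub_le (h₁.sub hf).1 (h₂.sub hf).1 (by norm_num)).trans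
      (add_le_add (e₁.trans ?_) (e₂.trans ?_)) <;>
    exact ENNReal.ofReal_le_ofReal (Nat.one_div_le_one_div ‹_›)
  set F : ℕ → Lp ℂ 2 B.arcLength := fun n => (m3 n).toLp (φ n) with hF
  have hcauchy : CauchySeq F := by
    -- The trace inequality makes the restrictions Cauchy in L²(∂Ω); the factor 3 counts two partial
    -- derivatives and the function itself.
    refine cauchySeq_of_le_tendsto_0 (fun N : ℕ => √(A * 3) * (2 * (1 / ((N : ℝ) + 1)))) ?_ ?_
    · intro n p N hn hp
      have e1 := htr (φ n - φ p) ((hφ n).sub (hφ p)) ((hcs n).sub (hcs p))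
      rw [integral_norm_sq_eq ((m3 n).sub (m3 p)), Fin.sum_univ_two, pderiv_sub (hφ n) (hφ p),
        pderiv_sub (hφ n) (hφ p)] at e1
      have k1 := key hn hp (m1 n) (m1 p) hu.memLp (hφu n) (hφu p)
      have k2 := fun i => key hn hp (m2 n i) (m2 p i) (hu.memLp_grad i) (hφg n i) (hφg p i)
      rw [Lp.dist_def, eLpNorm_congr_ae ((m3 n).coeFn_toLp.sub (m3 p).coeFn_toLp)]
      refine abs_le_of_sq_le_sq' ?_ (by positivity) |>.2
      refine e1.trans ?_
      rw [mul_pow, Real.sq_sqrt (by positivity), mul_assoc]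
      refine mul_le_mul_of_nonneg_left ?_ hA.le
      linarith [k2 0, k2 1]
    · simpa using (hlim0.const_mul 2).const_mul √(A * 3)
  obtain ⟨a, ha⟩ := cauchySeq_tendsto_of_complete hcauchy
  refine ⟨a, Lp.memLp a, φ, fun n => ⟨hφ n, hcs n⟩, ?_, fun i => ?_, ?_⟩
  · exact tendsto_of_tendsto_of_tendsto_of_le_of_le tendsto_const_nhds hlim
      (fun _ => zero_le) hφu
  · exact tendsto_of_tendsto_of_tendsto_of_le_of_le tendsto_const_nhds hlim
      (fun _ => zero_le) fun n => hφg n i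
  · rw [Lp.tendsto_Lp_iff_tendsto_eLpNorm'] at ha
    refine ha.congr fun n => eLpNorm_congr_ae ?_
    exact (m3 n).coeFn_toLp.sub (EventuallyEq.refl _ _)

end SmoothBoundary
end RobinLaplacian
end

/-! ### Inward shift and mollification -/

noncomputable section

namespace RobinLaplacian

namespace SmoothBoundary

variable {Ω : Set Plane} {m : ℕ} (B : SmoothBoundary Ω m)

/-- There is a smooth compactly supported field that points inwards near the boundary. -/
theorem exists_inward_field : ∃ X : Plane → Plane, ContDiff ℝ ∞ X ∧ HasCompactSupport X ∧
    ∃ r > 0, ∀ j s x, dist x (B.M j s) ≤ r → 1 / 2 ≤ (inner ℝ (B.normal j s) (X x) : ℝ) := by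
  obtain ⟨K, hK1, hK⟩ := B.exists_curvature_bound
  have hK0 : 0 < K := by linarith
  -- Parameters within 1/K have normals at distance at most 1, hence with inner product 1 - |N -
  -- N'|²/2 ≥ 1/2.
  obtain ⟨r₀, hr₀, hsep⟩ := B.exists_separation (η := 1 / K) (by positivity)
  have hinner : ∀ j k s s', dist (B.M j s) (B.M k s') < r₀ →
      1 / 2 ≤ (inner ℝ (B.normal j s) (B.normal k s') : ℝ) := by
    intro j k s s' h
    obtain ⟨rfl, n, hn⟩ := hsep j k s s' h
    have h1 := B.norm_normal_sub_le hK j s (s' + n * B.L j)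
    rw [normal_add_int_mul] at h1
    have h2 : ‖B.normal j s' - B.normal j s‖ ≤ 1 := by
      refine h1.trans ((mul_le_mul_of_nonneg_left hn.le hK0.le).trans ?_)
      rw [mul_one_div_cancel hK0.ne']
    have h3 := norm_sub_sq_real (B.normal j s') (B.normal j s)
    rw [norm_normal, norm_normal, real_inner_comm] at h3
    nlinarith [norm_nonneg (B.normal j s' - B.normal j s)]
  set r := r₀ / 8 with hr
  have hrpos : 0 < r := by positivity
  obtain ⟨t, ht⟩ := B.isCompact_frontier.elim_finite_subcover
    (fun p : Fin m × ℝ => Metric.ball (B.M p.1 p.2) r) (fun _ => Metric.isOpen_ball) (by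
      intro x hx
      rw [B.frontier_eq] at hx
      obtain ⟨j, s, rfl⟩ := Set.mem_iUnion.1 hx
      exact Set.mem_iUnion.2 ⟨(j, s), Metric.mem_ball_self hrpos⟩)
  -- No partition of unity is needed: near the boundary every term has nonnegative normal component
  -- and one of them has at least 1/2. A bump active within r of M s has its centre within 4r < r₀
  -- of M s.
  let χ : (p : Fin m × ℝ) → ContDiffBump (B.M p.1 p.2) := fun p =>
    ⟨2 * r, 3 * r, by positivity, by linarith⟩
  refine ⟨fun x => ∑ p ∈ t, χ p x • B.normal p.1 p.2, ?_, ?_, r, hrpos, ?_⟩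
  · exact ContDiff.sum fun p _ => (χ p).contDiff.smul contDiff_const
  · refine HasCompactSupport.intro (K := ⋃ p ∈ t, Metric.closedBall (B.M p.1 p.2) (3 * r))
      (t.isCompact_biUnion fun p _ => isCompact_closedBall _ _) fun x hx => ?_
    refine Finset.sum_eq_zero fun p hp => ?_
    rw [(χ p).zero_of_le_dist, zero_smul]
    by_contra h
    exact hx (Set.mem_iUnion₂.2 ⟨p, hp, (not_le.1 h).le⟩)
  · intro j s x hx
    simp only [inner_sum, inner_smul_right]
    have hnn : ∀ p ∈ t, 0 ≤ χ p x * (inner ℝ (B.normal j s) (B.normal p.1 p.2) : ℝ) := by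
      intro p _
      by_cases h : 3 * r ≤ dist x (B.M p.1 p.2)
      · rw [(χ p).zero_of_le_dist h, zero_mul]
      · refine mul_nonneg (χ p).nonneg ?_
        have := hinner j p.1 s p.2 (by
          have := dist_triangle_left (B.M j s) (B.M p.1 p.2) x
          linarith)
        linarith
    obtain ⟨p, hp, hps⟩ := Set.mem_iUnion₂.1 (ht (B.M_mem_frontier j s))
    rw [Metric.mem_ball] at hps
    refine le_trans ?_ (Finset.single_le_sum hnn hp)
    rw [(χ p).one_of_mem_closedBall, one_mul]
    · exact hinner j p.1 s p.2 (by linarith)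
    · rw [Metric.mem_closedBall]
      change _ ≤ 2 * r
      linarith [dist_triangle x (B.M j s) (B.M p.1 p.2)]

/-- Moving along the inward field by `4 δ` brings a `δ`-ball inside `Ω`. -/
theorem exists_shift_mem {X : Plane → Plane} {A r : ℝ} (hA : ∀ x, ‖X x‖ ≤ A) (hr : 0 < r)
    (hX : ∀ j s x, dist x (B.M j s) ≤ r → 1 / 2 ≤ (inner ℝ (B.normal j s) (X x) : ℝ)) :
    ∃ δ₀ > 0, ∀ δ, 0 < δ → δ < δ₀ → ∀ x ∈ Ω, ∀ y, dist y (x + (4 * δ) • X x) ≤ δ → y ∈ Ω := by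
  have hA0 : 0 ≤ A := (norm_nonneg _).trans (hA 0)
  obtain ⟨ε, hε⟩ := B.exists_isTubeRadius
  have hεpos := hε.pos
  -- Dδ bounds |y - x|: a shift of at most 4Aδ, then an error of at most δ.
  set D := 4 * A + 1 with hD
  have hDpos : 0 < D := by positivity
  obtain ⟨rc, hrc, hcone⟩ := B.exists_cone (c := 1 / (2 * D)) (by positivity)
  refine ⟨min (ε / D) (min (r / D) (rc / (2 * D))), by positivity, ?_⟩
  intro δ hδ hδ0 x hx y hy
  have d1 : D * δ ≤ ε := by
    have := (lt_div_iff₀ hDpos).1 (hδ0.trans_le (min_le_left _ _)); linarith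
  have d2 : D * δ ≤ r := by
    have := (lt_div_iff₀ hDpos).1
      (hδ0.trans_le ((min_le_right _ _).trans (min_le_left _ _))); linarith
  have d3 : 2 * D * δ ≤ rc := by
    have := (lt_div_iff₀ (by positivity)).1
      (hδ0.trans_le ((min_le_right _ _).trans (min_le_right _ _))); linarith
  set e := y - (x + (4 * δ) • X x) with he
  have he1 : ‖e‖ ≤ δ := by rwa [dist_eq_norm] at hy
  have hsX : ‖(4 * δ) • X x‖ ≤ 4 * A * δ := by
    rw [norm_smul, Real.norm_of_nonneg (by positivity)]
    nlinarith [hA x]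
  have hyx : dist y x ≤ D * δ := by
    have : y - x = (4 * δ) • X x + e := by rw [he]; abel
    rw [dist_eq_norm, this]
    refine (norm_add_le _ _).trans ?_
    rw [hD]; linarith
  -- Far from the boundary the ball of radius Dδ about x stays in Ω. Otherwise x = M s + tN, the
  -- normal component of y - M s is at least t + 2δ - δ ≥ δ, and |y - M s| ≤ 2Dδ: y lies in the cone
  -- of slope 1/(2D).
  rcases lt_or_ge (D * δ) (Metric.infDist x (frontier Ω)) with h | h
  · refine subset_of_isPreconnected B.isOpen (convex_closedBall x (D * δ)).isPreconnected ?_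
      (Metric.mem_closedBall_self (by positivity)) hx hyx
    intro z hz hzf
    have := Metric.infDist_le_dist_of_mem (x := x) hzf
    rw [Metric.mem_closedBall, dist_comm] at hz
    linarith
  · obtain ⟨j, s, t, ht0, ht1, rfl⟩ := hε.exists_eq_tube hx (h.trans d1)
    rw [← ht1] at h
    have hdist : dist (B.tube j s t) (B.M j s) = t := by
      rw [dist_eq_norm, norm_tube_sub, abs_of_pos ht0]
    have hi := hX j s (B.tube j s t) (by rw [hdist]; linarith)
    have hyM : ‖y - B.M j s‖ ≤ 2 * D * δ := by
      rw [← dist_eq_norm]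
      linarith [dist_triangle y (B.tube j s t) (B.M j s)]
    have hin : δ ≤ (inner ℝ (B.normal j s) (y - B.M j s) : ℝ) := by
      have : y - B.M j s = t • B.normal j s + (4 * δ) • X (B.tube j s t) + e := by
        rw [he]; simp only [tube]; abel
      rw [this, inner_add_right, inner_add_right, inner_smul_right, inner_smul_right,
        real_inner_self_eq_norm_sq, norm_normal]
      have h2 := abs_real_inner_le_norm (B.normal j s) e
      rw [norm_normal, one_mul] at h2
      have h3 := (abs_le.1 h2).1
      nlinarith
    refine hcone j s y (hyM.trans d3) (by linarith) (le_trans ?_ hin)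
    rw [div_mul_eq_mul_div, one_mul, div_le_iff₀ (by positivity)]
    linarith

end SmoothBoundary

/-- A smoothing kernel at scale `δ`. -/
structure IsMollifier (ρ : Plane → ℝ) (δ : ℝ) : Prop where
  contDiff : ContDiff ℝ ∞ ρ
  nonneg : ∀ x, 0 ≤ ρ x
  support_subset : Function.support ρ ⊆ Metric.ball 0 δ
  integral_eq : ∫ x, ρ x = 1
  le : ∀ x, ρ x ≤ 1 / volume.real (Metric.closedBall (0 : Plane) (δ / 2))

theorem exists_isMollifier {δ : ℝ} (hδ : 0 < δ) : ∃ ρ, IsMollifier ρ δ := by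
  let f : ContDiffBump (0 : Plane) := ⟨δ / 2, δ, by positivity, by linarith⟩
  exact ⟨f.normed volume, f.contDiff_normed, f.nonneg_normed, (f.support_normed_eq).subset,
    f.integral_normed, f.normed_le_div_measure_closedBall_rIn volume⟩

theorem IsMollifier.hasCompactSupport {ρ : Plane → ℝ} {δ : ℝ} (h : IsMollifier ρ δ) :
    HasCompactSupport ρ :=
  HasCompactSupport.of_support_subset_isCompact (isCompact_closedBall 0 δ)
    (h.support_subset.trans Metric.ball_subset_closedBall)

/-- The convolution with `ρ`, precomposed with `ψ`. -/
def mollify (ρ : Plane → ℝ) (ψ : Plane → Plane) (f : Plane → ℂ) (x : Plane) : ℂ :=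
  convolution ρ f (ContinuousLinearMap.lsmul ℝ ℝ) volume (ψ x)

theorem mollify_eq (ρ : Plane → ℝ) (ψ : Plane → Plane) (f : Plane → ℂ) (x : Plane) :
    mollify ρ ψ f x = ∫ t, ρ (ψ x - t) • f t := by
  rw [mollify, convolution_eq_swap]; rfl

theorem eLpNorm_two_sq {α E : Type*} [MeasurableSpace α] [NormedAddCommGroup E] (f : α → E)
    (μ : Measure α) : eLpNorm f 2 μ ^ 2 = ∫⁻ x, ‖f x‖ₑ ^ 2 ∂μ := by
  have := eLpNorm_nnreal_pow_eq_lintegral (f := f) (μ := μ) (p := 2) (by norm_num)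
  simpa using this

theorem lintegral_enorm_sq_le {α E : Type*} [MeasurableSpace α] [NormedAddCommGroup E] {f : α → E}
    {μ : Measure α} (hf : AEStronglyMeasurable f μ) :
    (∫⁻ x, ‖f x‖ₑ ∂μ) ^ 2 ≤ μ Set.univ * ∫⁻ x, ‖f x‖ₑ ^ 2 ∂μ := by
  have h := eLpNorm_le_eLpNorm_mul_rpow_measure_univ (p := 1) (q := 2) (μ := μ) (by norm_num) hf
  rw [eLpNorm_one_eq_lintegral_enorm] at h
  refine (pow_le_pow_left' h 2).trans ?_
  rw [mul_pow, eLpNorm_two_sq, mul_comm, ← ENNReal.rpow_natCast (_ ^ _) 2, ← ENNReal.rpow_mul]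
  norm_num

/-- Tonelli: the centres x whose ball contains y fill the ball of the same radius about y. -/
theorem lintegral_lintegral_closedBall {F : Plane → ENNReal} (hF : AEMeasurable F) (R : ℝ) :
    ∫⁻ x, ∫⁻ y in Metric.closedBall x R, F y =
      volume (Metric.closedBall (0 : Plane) R) * ∫⁻ y, F y := by
  set S : Set (Plane × Plane) := {p | dist p.2 p.1 ≤ R} with hS
  have hSm : MeasurableSet S := (isClosed_le (by fun_prop) continuous_const).measurableSet
  have h1 : ∀ x, ∫⁻ y in Metric.closedBall x R, F y = ∫⁻ y, S.indicator 1 (x, y) * F y := by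
    intro x
    rw [← lintegral_indicator Metric.isClosed_closedBall.measurableSet]
    refine lintegral_congr fun y => ?_
    by_cases h : dist y x ≤ R
    · rw [Set.indicator_of_mem (Metric.mem_closedBall.2 h), Set.indicator_of_mem (by exact h)]
      simp
    · rw [Set.indicator_of_notMem (by exact h), Set.indicator_of_notMem (by exact h), zero_mul]
  have h2 : ∀ y, ∫⁻ x, S.indicator 1 (x, y) * F y =
      volume (Metric.closedBall (0 : Plane) R) * F y := by
    intro y
    have hm : Measurable fun x => S.indicator (1 : Plane × Plane → ENNReal) (x, y) :=
      (measurable_one.indicator hSm).comp measurable_prodMk_right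
    rw [lintegral_mul_const _ hm]
    congr 1
    have : (fun x => S.indicator (1 : Plane × Plane → ENNReal) (x, y)) =
        (Metric.closedBall y R).indicator 1 := by
      ext x
      by_cases h : dist y x ≤ R
      · rw [Set.indicator_of_mem (by exact h),
          Set.indicator_of_mem (Metric.mem_closedBall.2 (by rwa [dist_comm]))]; rfl
      · rw [Set.indicator_of_notMem (by exact h), Set.indicator_of_notMem (by
          rwa [Metric.mem_closedBall, dist_comm])]
    rw [this, lintegral_indicator_one Metric.isClosed_closedBall.measurableSet]
    exact Measure.addHaar_closedBall_center volume y R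
  calc _ = ∫⁻ x, ∫⁻ y, S.indicator 1 (x, y) * F y := lintegral_congr h1
    _ = ∫⁻ y, ∫⁻ x, S.indicator 1 (x, y) * F y := by
        refine lintegral_lintegral_swap ?_
        exact (measurable_one.indicator hSm).aemeasurable.mul hF.comp_snd
    _ = _ := by
        rw [lintegral_congr h2, lintegral_const_mul'' _ hF]

variable {ρ : Plane → ℝ} {δ A : ℝ} {ψ : Plane → Plane}

theorem IsMollifier.contDiff_mollify (hρ : IsMollifier ρ δ) (hψ : ContDiff ℝ ∞ ψ)
    {f : Plane → ℂ} (hf : MemLp f 2) : ContDiff ℝ ∞ (mollify ρ ψ f) :=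
  ContDiff.comp (hρ.hasCompactSupport.contDiff_convolution_left (n := ⊤) _ hρ.contDiff
    (hf.locallyIntegrable (by norm_num))) hψ

/-- The kernel at ψ x lives within (A + 1)δ of x. Majorizing by a mean around x instead of ψ x
avoids any change of variables by ψ. -/
theorem IsMollifier.enorm_mollify_le (hρ : IsMollifier ρ δ)
    (hψA : ∀ x, dist (ψ x) x ≤ A * δ) (f : Plane → ℂ) (x : Plane) :
    ‖mollify ρ ψ f x‖ₑ ≤
      ENNReal.ofReal (1 / volume.real (Metric.closedBall (0 : Plane) (δ / 2))) *
        ∫⁻ y in Metric.closedBall x ((A + 1) * δ), ‖f y‖ₑ := by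
  rw [mollify_eq, ← lintegral_const_mul' _ _ ENNReal.ofReal_ne_top]
  refine (enorm_integral_le_lintegral_enorm _).trans ?_
  rw [← lintegral_indicator Metric.isClosed_closedBall.measurableSet]
  refine lintegral_mono fun y => ?_
  by_cases h : ρ (ψ x - y) = 0
  · rw [h, zero_smul, enorm_zero]; exact zero_le
  · have h1 := hρ.support_subset h
    rw [mem_ball_zero_iff, ← dist_eq_norm] at h1
    rw [Set.indicator_of_mem, enorm_smul]
    · refine mul_le_mul' ?_ le_rfl
      rw [Real.enorm_eq_ofReal (hρ.nonneg _)]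
      exact ENNReal.ofReal_le_ofReal (hρ.le _)
    · rw [Metric.mem_closedBall, dist_comm]
      linarith [dist_triangle_left x y (ψ x), hψA x]

/-- Mollification is bounded on `L²`, uniformly in the scale. -/
theorem IsMollifier.eLpNorm_mollify_le (hδ : 0 < δ) (hA : 0 ≤ A) (hρ : IsMollifier ρ δ)
    (hψA : ∀ x, dist (ψ x) x ≤ A * δ) {f : Plane → ℂ} (hf : AEStronglyMeasurable f) :
    eLpNorm (mollify ρ ψ f) 2 ≤ ENNReal.ofReal (4 * (A + 1) ^ 2) * eLpNorm f 2 := by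
  set k := ENNReal.ofReal (1 / volume.real (Metric.closedBall (0 : Plane) (δ / 2))) with hk
  set R := (A + 1) * δ with hR
  set V := volume (Metric.closedBall (0 : Plane) R) with hV
  -- The ratio of the areas of discs of radii (A + 1)δ and δ/2, independent of δ.
  have hkV : k * V = ENNReal.ofReal (4 * (A + 1) ^ 2) := by
    have hRpos : 0 ≤ R := by positivity
    have hpos : 0 < volume.real (Metric.ball (0 : Plane) 1) :=
      ENNReal.toReal_pos (Metric.measure_ball_pos _ _ one_pos).ne' measure_ball_lt_top.ne
    have e1 : V = ENNReal.ofReal (volume.real (Metric.closedBall (0 : Plane) R)) :=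
      (ENNReal.ofReal_toReal measure_closedBall_lt_top.ne).symm
    rw [hk, e1, ← ENNReal.ofReal_mul (by positivity)]
    congr 1
    have e2 : ∀ {r : ℝ}, 0 ≤ r → volume.real (Metric.closedBall (0 : Plane) r) =
        r ^ 2 * volume.real (Metric.ball (0 : Plane) 1) := by
      intro r hr
      rw [Measure.real, Measure.addHaar_closedBall _ _ hr, ENNReal.toReal_mul,
        ENNReal.toReal_ofReal (by positivity), finrank_euclideanSpace_fin, Measure.real]
    rw [e2 hRpos, e2 (by positivity), hR]
    field_simp
    ring
  have hsq : eLpNorm (mollify ρ ψ f) 2 ^ 2 ≤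
      (ENNReal.ofReal (4 * (A + 1) ^ 2) * eLpNorm f 2) ^ 2 := by
    rw [mul_pow, eLpNorm_two_sq, eLpNorm_two_sq, ← hkV]
    -- Cauchy–Schwarz on each ball, then Tonelli; the constant is (kV)².
    calc ∫⁻ x, ‖mollify ρ ψ f x‖ₑ ^ 2
        ≤ ∫⁻ x, k ^ 2 * V * ∫⁻ y in Metric.closedBall x R, ‖f y‖ₑ ^ 2 := by
          refine lintegral_mono fun x => ?_
          refine (pow_le_pow_left' (hρ.enorm_mollify_le hψA f x) 2).trans ?_
          rw [mul_pow, mul_assoc]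
          refine mul_le_mul' le_rfl ((lintegral_enorm_sq_le hf.restrict).trans (le_of_eq ?_))
          rw [Measure.restrict_apply_univ, hV, Measure.addHaar_closedBall_center]
      _ = k ^ 2 * V * (V * ∫⁻ y, ‖f y‖ₑ ^ 2) := by
          rw [lintegral_const_mul' _ _ (ENNReal.mul_ne_top (by simp [hk])
            measure_closedBall_lt_top.ne), lintegral_lintegral_closedBall (hf.enorm.pow_const 2)]
      _ = _ := by ring
  by_contra hlt
  exact absurd hsq (not_le.2 (ENNReal.pow_lt_pow_left two_ne_zero (not_le.1 hlt)))

theorem IsMollifier.mollify_sub (hρ : IsMollifier ρ δ) {f g : Plane → ℂ} (hf : MemLp f 2)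
    (hg : MemLp g 2) : mollify ρ ψ (f - g) = mollify ρ ψ f - mollify ρ ψ g := by
  have hint : ∀ {f : Plane → ℂ}, MemLp f 2 → ∀ x, Integrable fun t => ρ (ψ x - t) • f t :=
    fun hf x => (hρ.hasCompactSupport.convolutionExists_left (ContinuousLinearMap.lsmul ℝ ℝ)
      hρ.contDiff.continuous (hf.locallyIntegrable (by norm_num)) (ψ x)).integrable_swap
  ext x
  rw [Pi.sub_apply, mollify_eq, mollify_eq, mollify_eq, ← integral_sub (hint hf x) (hint hg x)]
  simp only [Pi.sub_apply, smul_sub]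

/-- Mollification converges in `L²` on continuous functions with compact support. -/
theorem exists_eLpNorm_mollify_sub_le_of_continuous {g : Plane → ℂ} (hg : Continuous g)
    (hgc : HasCompactSupport g) (hA : 0 ≤ A) {κ : ℝ} (hκ : 0 < κ) :
    ∃ δ₁ > 0, ∀ δ, 0 < δ → δ < δ₁ → ∀ ρ, IsMollifier ρ δ → ∀ ψ : Plane → Plane,
      (∀ x, dist (ψ x) x ≤ A * δ) → eLpNorm (mollify ρ ψ g - g) 2 ≤ ENNReal.ofReal κ := by
  -- Once (A + 1)δ < 1, both g and its mollification vanish off S, so a uniform error e on S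
  -- suffices.
  set S := Metric.cthickening 1 (tsupport g) with hS
  have hScomp : IsCompact S := hgc.isCompact.cthickening
  have hSm : MeasurableSet S := hScomp.isClosed.measurableSet
  set c := volume.real S ^ (1 / 2 : ℝ) with hc
  have hc0 : 0 ≤ c := by positivity
  set e := κ / (c + 1) with he
  have hepos : 0 < e := by positivity
  obtain ⟨d, hd, hunif⟩ := Metric.uniformContinuous_iff.1
    (hgc.uniformContinuous_of_continuous hg) e hepos
  refine ⟨min (1 / (A + 1)) (d / (A + 1)), by positivity, fun δ hδ hδ1 ρ hρ ψ hψ => ?_⟩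
  have d1 : (A + 1) * δ < 1 := by
    have := (lt_div_iff₀ (by positivity)).1 (hδ1.trans_le (min_le_left _ _)); linarith
  have d2 : (A + 1) * δ < d := by
    have := (lt_div_iff₀ (by positivity)).1 (hδ1.trans_le (min_le_right _ _)); linarith
  have hball : ∀ x, ∀ y ∈ Metric.ball (ψ x) δ, dist y x < (A + 1) * δ := by
    intro x y hy
    rw [Metric.mem_ball] at hy
    linarith [dist_triangle y (ψ x) x, hψ x]
  have hb : ∀ x, ‖(mollify ρ ψ g - g) x‖ ≤ S.indicator (fun _ => e) x := by
    intro x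
    rw [Pi.sub_apply, ← dist_eq_norm]
    by_cases hx : x ∈ S
    · rw [Set.indicator_of_mem hx]
      exact dist_convolution_le hepos.le hρ.support_subset hρ.nonneg hρ.integral_eq
        hg.aestronglyMeasurable fun y hy => (hunif ((hball x y hy).trans d2)).le
    · rw [Set.indicator_of_notMem hx]
      have hout : ∀ y, dist y x < 1 → g y = 0 := by
        intro y hy
        by_contra h
        refine hx (Metric.mem_cthickening_of_dist_le x y 1 _ (subset_tsupport _ h) ?_)
        rw [dist_comm]; exact hy.le
      refine dist_convolution_le le_rfl hρ.support_subset hρ.nonneg hρ.integral_eq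
        hg.aestronglyMeasurable fun y hy => ?_
      rw [hout y ((hball x y hy).trans d1), hout x (by simp), dist_self]
  refine (eLpNorm_mono_real hb).trans ?_
  rw [eLpNorm_indicator_const hSm (by norm_num) (by norm_num), Real.enorm_eq_ofReal hepos.le,
    ← ENNReal.ofReal_toReal hScomp.measure_lt_top.ne, ENNReal.toReal_ofNat,
    ENNReal.ofReal_rpow_of_nonneg ENNReal.toReal_nonneg (by norm_num),
    ← ENNReal.ofReal_mul hepos.le]
  refine ENNReal.ofReal_le_ofReal ?_
  change e * c ≤ κ
  rw [he, div_mul_eq_mul_div, div_le_iff₀ (by positivity)]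
  nlinarith

/-- Mollification converges in `L²`. -/
theorem exists_eLpNorm_mollify_sub_le {f : Plane → ℂ} (hf : MemLp f 2) (hA : 0 ≤ A) {κ : ℝ}
    (hκ : 0 < κ) :
    ∃ δ₁ > 0, ∀ δ, 0 < δ → δ < δ₁ → ∀ ρ, IsMollifier ρ δ → ∀ ψ : Plane → Plane,
      ContDiff ℝ ∞ ψ → (∀ x, dist (ψ x) x ≤ A * δ) →
      eLpNorm (mollify ρ ψ f - f) 2 ≤ ENNReal.ofReal κ := by
  -- Three errors: the mollified difference f - g costs 4(A + 1)²κ', the mollification of g and the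
  -- difference f - g itself cost κ' each.
  set κ' := κ / (4 * (A + 1) ^ 2 + 2) with hκ'
  have hκ'pos : 0 < κ' := by positivity
  obtain ⟨g, hgc, hfg, hg, hgL⟩ := hf.exists_hasCompactSupport_eLpNorm_sub_le (by norm_num)
    (ENNReal.ofReal_pos.2 hκ'pos).ne'
  obtain ⟨δ₁, hδ₁, h⟩ := exists_eLpNorm_mollify_sub_le_of_continuous hg hgc hA hκ'pos
  refine ⟨δ₁, hδ₁, fun δ hδ hδ1 ρ hρ ψ hψ hψA => ?_⟩
  have h1 := h δ hδ hδ1 ρ hρ ψ hψA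
  have h2 := hρ.eLpNorm_mollify_le hδ hA hψA (hf.sub hgL).1
  have e : mollify ρ ψ f - f =
      (mollify ρ ψ (f - g) + (mollify ρ ψ g - g)) - (f - g) := by
    rw [hρ.mollify_sub hf hgL]; abel
  have hm1 := (hρ.contDiff_mollify hψ (hf.sub hgL)).continuous.aestronglyMeasurable (μ := volume)
  have hm2 := (hρ.contDiff_mollify hψ hgL).continuous.aestronglyMeasurable (μ := volume)
  rw [e]
  calc _ ≤ _ := eLpNorm_sub_le (hm1.add (hm2.sub hgL.1)) (hf.sub hgL).1 (by norm_num)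
    _ ≤ _ := add_le_add_left (eLpNorm_add_le hm1 (hm2.sub hgL.1) (by norm_num)) _
    _ ≤ ENNReal.ofReal (4 * (A + 1) ^ 2) * ENNReal.ofReal κ' + ENNReal.ofReal κ' +
        ENNReal.ofReal κ' := add_le_add (add_le_add (h2.trans (mul_le_mul' le_rfl hfg)) h1) hfg
    _ = ENNReal.ofReal κ := by
        rw [← ENNReal.ofReal_mul (by positivity), ← ENNReal.ofReal_add (by positivity)
          hκ'pos.le, ← ENNReal.ofReal_add (by positivity) hκ'pos.le]
        congr 1
        rw [hκ']; field_simp; ring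

end RobinLaplacian
end

/-! ### Truncation and density of smooth functions in H¹ -/

noncomputable section

namespace RobinLaplacian

variable {ρ : Plane → ℝ} {δ A : ℝ} {ψ : Plane → Plane}

/-- Dominated convergence for the squares, in the form suited to cutoffs: at each point the error is
eventually exactly zero. -/
theorem tendsto_eLpNorm_two_of_dominated {E F : Type*} [NormedAddCommGroup E]
    [NormedAddCommGroup F] {μ : Measure Plane} {f : ℕ → Plane → E} {b : Plane → F} {c : ℝ}
    (hf : ∀ n, AEStronglyMeasurable (f n) μ) (hb : MemLp b 2 μ)
    (hfb : ∀ n x, ‖f n x‖ ≤ c * ‖b x‖) (hlim : ∀ x, ∀ᶠ n in atTop, f n x = 0) :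
    Tendsto (fun n => eLpNorm (f n) 2 μ) atTop (𝓝 0) := by
  have hsq : Tendsto (fun n => eLpNorm (f n) 2 μ ^ 2) atTop (𝓝 0) := by
    simp only [eLpNorm_two_sq]
    have hc : MemLp (fun x => c • ‖b x‖) 2 μ := hb.norm.const_smul c
    have := tendsto_lintegral_of_dominated_convergence' (μ := μ) (F := fun n x => ‖f n x‖ₑ ^ 2)
      (f := fun _ => 0) (fun x => ‖c • ‖b x‖‖ₑ ^ 2) (fun n => (hf n).enorm.pow_const 2)
      (fun n => Eventually.of_forall fun x => by
        refine pow_le_pow_left' ?_ 2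
        exact enorm_le_iff_norm_le.2 ((hfb n x).trans (le_abs_self _)))
      (by rw [← eLpNorm_two_sq]; exact ENNReal.pow_ne_top hc.2.ne)
      (Eventually.of_forall fun x => by
        refine tendsto_const_nhds.congr' ((hlim x).mono fun n hn => ?_)
        simp [hn])
    simpa using this
  have h2 := (ENNReal.continuous_rpow_const (y := 1 / 2)).tendsto 0 |>.comp hsq
  rw [ENNReal.zero_rpow_of_pos (by norm_num)] at h2
  refine h2.congr fun n => ?_
  simp only [Function.comp]
  rw [← ENNReal.rpow_natCast, ← ENNReal.rpow_mul]
  norm_num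

theorem pderiv_smul {χ : Plane → ℝ} {v : Plane → ℂ} (hχ : ContDiff ℝ ∞ χ) (hv : ContDiff ℝ ∞ v)
    (i : Fin 2) : pderiv i (fun x => χ x • v x) =
      fun x => χ x • pderiv i v x + pderiv i χ x • v x := by
  ext x
  simp only [pderiv]
  rw [fderiv_fun_smul (hχ.differentiable (by simp) x) (hv.differentiable (by simp) x)]
  simp

/-- Truncation of smooth functions at infinity. -/
theorem exists_hasCompactSupport_approx {Ω : Set Plane} {v : Plane → ℂ} (hv : ContDiff ℝ ∞ v)
    (hv2 : MemLp v 2 (volume.restrict Ω)) (hdv : ∀ i, MemLp (pderiv i v) 2 (volume.restrict Ω))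
    {κ : ℝ} (hκ : 0 < κ) :
    ∃ φ : Plane → ℂ, ContDiff ℝ ∞ φ ∧ HasCompactSupport φ ∧
      eLpNorm (φ - v) 2 (volume.restrict Ω) ≤ ENNReal.ofReal κ ∧
      ∀ i, eLpNorm (pderiv i φ - pderiv i v) 2 (volume.restrict Ω) ≤ ENNReal.ofReal κ := by
  let f : ContDiffBump (0 : Plane) := ⟨1, 2, one_pos, one_lt_two⟩
  set χ : ℕ → Plane → ℝ := fun n x => f (((n : ℝ) + 1)⁻¹ • x) with hχdef
  have hχ : ∀ n, ContDiff ℝ ∞ (χ n) := fun n => f.contDiff.comp (contDiff_const_smul _)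
  have hpos : ∀ n : ℕ, 0 < (n : ℝ) + 1 := fun n => by positivity
  have hχc : ∀ n, HasCompactSupport (χ n) := fun n =>
    f.hasCompactSupport.comp_smul (inv_pos.2 (hpos n)).ne'
  have hχ01 : ∀ n x, |χ n x - 1| ≤ 1 := fun n x => by
    rw [abs_le]; constructor <;> linarith [f.nonneg (x := ((n : ℝ) + 1)⁻¹ • x), f.le_one (x := ((n : ℝ) + 1)⁻¹ • x)]
  -- Equality on a neighbourhood, not only at x, so that the derivatives of the cutoff vanish at x
  -- too.
  have hχ1 : ∀ x : Plane, ∀ᶠ n in atTop, ∀ᶠ y in 𝓝 x, χ n y = 1 := by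
    intro x
    obtain ⟨N, hN⟩ := exists_nat_gt ‖x‖
    filter_upwards [eventually_ge_atTop N] with n hn
    have hx : ‖x‖ < (n : ℝ) + 1 := by
      have : (N : ℝ) ≤ n := by exact_mod_cast hn
      linarith
    filter_upwards [(isOpen_lt continuous_norm continuous_const).mem_nhds hx] with y hy
    refine f.one_of_mem_closedBall ?_
    rw [mem_closedBall_zero_iff, norm_smul, norm_inv, Real.norm_of_nonneg (hpos n).le,
      inv_mul_le_iff₀ (hpos n)]
    change ‖y‖ ≤ ((n : ℝ) + 1) * 1
    rw [mul_one]; exact le_of_lt hy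
  obtain ⟨c, hc⟩ : ∃ c, ∀ i x, ‖pderiv i f x‖ ≤ c := by
    have : ∀ i, ∃ c, ∀ x, ‖pderiv i f x‖ ≤ c := fun i =>
      (contDiff_pderiv f.contDiff i).continuous.bounded_above_of_compact_support
        (hasCompactSupport_pderiv f.hasCompactSupport i)
    choose c hc using this
    exact ⟨max (c 0) (c 1), fun i x => by
      fin_cases i
      · exact (hc 0 x).trans (le_max_left _ _)
      · exact (hc 1 x).trans (le_max_right _ _)⟩
  have hdχ : ∀ n i x, ‖pderiv i (χ n) x‖ ≤ c := by
    intro n i x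
    have e : pderiv i (χ n) x = ((n : ℝ) + 1)⁻¹ • pderiv i f (((n : ℝ) + 1)⁻¹ • x) := by
      simp only [pderiv, hχdef]
      rw [fderiv_comp_smul (f := f)]
      rfl
    rw [e, norm_smul, norm_inv, Real.norm_of_nonneg (hpos n).le]
    have h1 : ((n : ℝ) + 1)⁻¹ ≤ 1 := inv_le_one_of_one_le₀ (by linarith [Nat.cast_nonneg (α := ℝ) n])
    calc _ ≤ 1 * ‖pderiv i f (((n : ℝ) + 1)⁻¹ • x)‖ :=
          mul_le_mul_of_nonneg_right h1 (norm_nonneg _)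
      _ ≤ c := by rw [one_mul]; exact hc i _
  have hdχ0 : ∀ i (x : Plane), ∀ᶠ n in atTop, pderiv i (χ n) x = 0 := by
    intro i x
    filter_upwards [hχ1 x] with n hn
    have h1 : χ n =ᶠ[𝓝 x] fun _ => 1 := hn
    rw [pderiv, h1.fderiv_eq]
    simp
  have l1 : Tendsto (fun n => eLpNorm ((fun x => χ n x • v x) - v) 2 (volume.restrict Ω)) atTop
      (𝓝 0) := by
    refine tendsto_eLpNorm_two_of_dominated (c := 1) (fun n => ?_) hv2 (fun n x => ?_) fun x => ?_
    · exact (((hχ n).smul hv).sub hv).continuous.aestronglyMeasurable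
    · have : ((fun x => χ n x • v x) - v) x = (χ n x - 1) • v x := by
        rw [sub_smul, one_smul]; rfl
      rw [this, norm_smul]
      exact mul_le_mul_of_nonneg_right (hχ01 n x) (norm_nonneg _)
    · filter_upwards [hχ1 x] with n hn
      simp [hn.self_of_nhds]
  have l2 : ∀ i, Tendsto (fun n => eLpNorm ((fun x => χ n x • pderiv i v x) - pderiv i v) 2
      (volume.restrict Ω)) atTop (𝓝 0) := by
    intro i
    refine tendsto_eLpNorm_two_of_dominated (c := 1) (fun n => ?_) (hdv i) (fun n x => ?_)
      fun x => ?_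
    · exact (((hχ n).smul (contDiff_pderiv hv i)).sub
        (contDiff_pderiv hv i)).continuous.aestronglyMeasurable
    · have : ((fun x => χ n x • pderiv i v x) - pderiv i v) x = (χ n x - 1) • pderiv i v x := by
        rw [sub_smul, one_smul]; rfl
      rw [this, norm_smul]
      exact mul_le_mul_of_nonneg_right (hχ01 n x) (norm_nonneg _)
    · filter_upwards [hχ1 x] with n hn
      simp [hn.self_of_nhds]
  have l3 : ∀ i, Tendsto (fun n => eLpNorm (fun x => pderiv i (χ n) x • v x) 2
      (volume.restrict Ω)) atTop (𝓝 0) := by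
    intro i
    refine tendsto_eLpNorm_two_of_dominated (c := c) (fun n => ?_) hv2 (fun n x => ?_) fun x => ?_
    · exact ((contDiff_pderiv (hχ n) i).smul hv).continuous.aestronglyMeasurable
    · rw [norm_smul]
      exact mul_le_mul_of_nonneg_right (hdχ n i x) (norm_nonneg _)
    · filter_upwards [hdχ0 i x] with n hn
      simp [hn]
  have l4 : ∀ i, Tendsto (fun n => eLpNorm (pderiv i (fun x => χ n x • v x) - pderiv i v) 2
      (volume.restrict Ω)) atTop (𝓝 0) := by
    intro i
    have h1 := (l2 i).add (l3 i)
    rw [add_zero] at h1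
    refine tendsto_of_tendsto_of_tendsto_of_le_of_le tendsto_const_nhds h1 (fun _ => zero_le)
      fun n => ?_
    have e : pderiv i (fun x => χ n x • v x) - pderiv i v =
        ((fun x => χ n x • pderiv i v x) - pderiv i v) + fun x => pderiv i (χ n) x • v x := by
      rw [pderiv_smul (hχ n) hv]
      ext x
      simp only [Pi.sub_apply, Pi.add_apply]
      ring
    simp only [e]
    refine eLpNorm_add_le ?_ ?_ (by norm_num)
    · exact (((hχ n).smul (contDiff_pderiv hv i)).sub
        (contDiff_pderiv hv i)).continuous.aestronglyMeasurable
    · exact ((contDiff_pderiv (hχ n) i).smul hv).continuous.aestronglyMeasurable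
  have hκ' : (0 : ENNReal) < ENNReal.ofReal κ := ENNReal.ofReal_pos.2 hκ
  obtain ⟨n, h1, h2, h3⟩ := ((l1.eventually (gt_mem_nhds hκ')).and
    (((l4 0).eventually (gt_mem_nhds hκ')).and ((l4 1).eventually (gt_mem_nhds hκ')))).exists
  refine ⟨fun x => χ n x • v x, (hχ n).smul hv, (hχc n).smul_right, h1.le, fun i => ?_⟩
  fin_cases i
  · exact h2.le
  · exact h3.le

/-- Derivatives of mollifications are mollifications of weak derivatives, where the kernel is
supported in `Ω`. -/
theorem IsMollifier.pderiv_convolution {Ω : Set Plane} (hΩ : MeasurableSet Ω)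
    (hρ : IsMollifier ρ δ) {u : Plane → ℂ} {g : Fin 2 → Plane → ℂ} (hu : IsH1 Ω u g) {z : Plane}
    (hz : ∀ y, dist y z ≤ δ → y ∈ Ω) (k : Fin 2) :
    pderiv k (convolution ρ (Ω.indicator u) (ContinuousLinearMap.lsmul ℝ ℝ) volume) z =
      convolution ρ (Ω.indicator (g k)) (ContinuousLinearMap.lsmul ℝ ℝ) volume z := by
  have hut : MemLp (Ω.indicator u) 2 := (memLp_indicator_iff_restrict hΩ).2 hu.memLp
  have hloc : LocallyIntegrable (Ω.indicator u) volume := hut.locallyIntegrable (by norm_num)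
  have hρ1 : ContDiff ℝ 1 ρ := hρ.contDiff.of_le (by exact_mod_cast le_top)
  have hd := (hρ.hasCompactSupport.hasFDerivAt_convolution_left
    (ContinuousLinearMap.lsmul ℝ ℝ : ℝ →L[ℝ] ℂ →L[ℝ] ℂ) hρ1 hloc z).fderiv
  rw [pderiv, hd, convolution_eq_swap, ContinuousLinearMap.integral_apply
    ((hρ.hasCompactSupport.fderiv (𝕜 := ℝ)).convolutionExists_left _
      (hρ1.continuous_fderiv (by simp)) hloc z).integrable_swap, convolution_eq_swap]
  have hind : ∀ (a : Plane → ℝ) (f : Plane → ℂ),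
      ∫ t, a t • Ω.indicator f t = ∫ t in Ω, a t • f t := by
    intro a f
    rw [← integral_indicator hΩ]
    refine integral_congr_ae (Eventually.of_forall fun t => ?_)
    by_cases ht : t ∈ Ω <;> simp [ht]
  -- The derivative falls on the kernel, and t ↦ ρ(z - t) is an admissible test function because its
  -- support lies in the closed δ-ball about z. The sign from t ↦ z - t cancels the one in the weak
  -- gradient.
  have hθ : ContDiff ℝ ∞ fun t => ρ (z - t) := hρ.contDiff.comp (contDiff_const.sub contDiff_id)
  have hθsupp : tsupport (fun t => ρ (z - t)) ⊆ Metric.closedBall z δ := by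
    refine closure_minimal (fun t ht => ?_) Metric.isClosed_closedBall
    have := hρ.support_subset (show z - t ∈ Function.support ρ from ht)
    rw [mem_ball_zero_iff, ← dist_eq_norm, dist_comm] at this
    exact this.le
  have hweak := hu.weak_grad k (fun t => ρ (z - t)) hθ
    ((isCompact_closedBall z δ).of_isClosed_subset (isClosed_tsupport _) hθsupp)
    (hθsupp.trans fun y hy => hz y hy)
  have hpd : ∀ t, pderiv k (fun t => ρ (z - t)) t = -(fderiv ℝ ρ (z - t) (EuclideanSpace.single k 1)) := by
    intro t
    have h1 : HasFDerivAt (fun t => ρ (z - t)) _ t :=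
      ((hρ1.differentiable (by simp)) (z - t)).hasFDerivAt.comp t
        ((hasFDerivAt_id (𝕜 := ℝ) t).const_sub z)
    rw [pderiv, h1.fderiv]
    simp
  change ∫ t, fderiv ℝ ρ (z - t) (EuclideanSpace.single k 1) • Ω.indicator u t =
    ∫ t, ρ (z - t) • Ω.indicator (g k) t
  rw [hind (fun t => fderiv ℝ ρ (z - t) (EuclideanSpace.single k 1)), hind (fun t => ρ (z - t))]
  simp only [hpd, neg_smul, integral_neg, neg_inj] at hweak
  exact hweak

namespace SmoothBoundary

variable {Ω : Set Plane} {m : ℕ}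

/-- Functions in `H¹(Ω)` are limits of restrictions of functions in `C_c^∞(ℝ²)`. -/
theorem exists_smooth_approx (B : SmoothBoundary Ω m) {u : Plane → ℂ} {g : Fin 2 → Plane → ℂ} (hu : IsH1 Ω u g) {κ : ℝ}
    (hκ : 0 < κ) : ∃ φ : Plane → ℂ, ContDiff ℝ ∞ φ ∧ HasCompactSupport φ ∧
      eLpNorm (φ - u) 2 (volume.restrict Ω) ≤ ENNReal.ofReal κ ∧
      ∀ i, eLpNorm (pderiv i φ - g i) 2 (volume.restrict Ω) ≤ ENNReal.ofReal κ := by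
  have hΩ : MeasurableSet Ω := B.isOpen.measurableSet
  obtain ⟨X, hX, hXc, r, hr, hXN⟩ := B.exists_inward_field
  obtain ⟨A₀, hA₀⟩ := hX.continuous.bounded_above_of_compact_support hXc
  obtain ⟨A₁, hA₁⟩ := (hX.continuous_fderiv (by simp)).bounded_above_of_compact_support
    (hXc.fderiv (𝕜 := ℝ))
  have hA₀0 : 0 ≤ A₀ := (norm_nonneg _).trans (hA₀ 0)
  have hA₁0 : 0 ≤ A₁ := (norm_nonneg _).trans (hA₁ 0)
  obtain ⟨δ₀, hδ₀, hshift⟩ := B.exists_shift_mem hA₀ hr hXN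
  have hut : MemLp (Ω.indicator u) 2 := (memLp_indicator_iff_restrict hΩ).2 hu.memLp
  have hgt : ∀ i, MemLp (Ω.indicator (g i)) 2 := fun i =>
    (memLp_indicator_iff_restrict hΩ).2 (hu.memLp_grad i)
  have hA : 0 ≤ 4 * A₀ := by positivity
  obtain ⟨δ₁, hδ₁, hm1⟩ := exists_eLpNorm_mollify_sub_le hut hA (show 0 < κ / 2 by positivity)
  obtain ⟨δ₂, hδ₂, hm2⟩ := exists_eLpNorm_mollify_sub_le (hgt 0) hA (show 0 < κ / 4 by positivity)
  obtain ⟨δ₃, hδ₃, hm3⟩ := exists_eLpNorm_mollify_sub_le (hgt 1) hA (show 0 < κ / 4 by positivity)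
  set c := 4 * (4 * A₀ + 1) ^ 2 with hc
  have hcpos : 0 < c := by positivity
  set n₀ := (eLpNorm (Ω.indicator (g 0)) 2).toReal with hn₀
  set n₁ := (eLpNorm (Ω.indicator (g 1)) 2).toReal with hn₁
  have hn₀0 : 0 ≤ n₀ := ENNReal.toReal_nonneg
  have hn₁0 : 0 ≤ n₁ := ENNReal.toReal_nonneg
  -- δP < κ/4 makes the gradient error caused by the nonconstant shift at most κ/4; the summand 1
  -- keeps P positive.
  set P := 4 * A₁ * (c * (n₀ + n₁)) + 1 with hP
  have hPpos : 0 < P := by positivity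
  obtain ⟨δ, hδ, hδlt⟩ := exists_between (show 0 < min δ₀ (min (min δ₁ (κ / 4 / P)) (min δ₂ δ₃)) by
    positivity)
  have b0 : δ < δ₀ := hδlt.trans_le (min_le_left _ _)
  have b1 : δ < δ₁ := hδlt.trans_le ((min_le_right _ _).trans
    ((min_le_left _ _).trans (min_le_left _ _)))
  have b4 : δ < κ / 4 / P := hδlt.trans_le ((min_le_right _ _).trans
    ((min_le_left _ _).trans (min_le_right _ _)))
  have b2 : δ < δ₂ := hδlt.trans_le ((min_le_right _ _).trans
    ((min_le_right _ _).trans (min_le_left _ _)))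
  have b3 : δ < δ₃ := hδlt.trans_le ((min_le_right _ _).trans
    ((min_le_right _ _).trans (min_le_right _ _)))
  obtain ⟨ρ, hρ⟩ := exists_isMollifier hδ
  set ψ : Plane → Plane := fun x => x + (4 * δ) • X x with hψdef
  have hψ : ContDiff ℝ ∞ ψ := contDiff_id.add (hX.const_smul (4 * δ))
  have hψA : ∀ x, dist (ψ x) x ≤ 4 * A₀ * δ := by
    intro x
    rw [dist_eq_norm, hψdef, add_sub_cancel_left, norm_smul, Real.norm_of_nonneg (by positivity)]
    nlinarith [hA₀ x]
  set v := mollify ρ ψ (Ω.indicator u) with hv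
  set G : Fin 2 → Plane → ℂ := fun k => mollify ρ ψ (Ω.indicator (g k)) with hG
  have hvs : ContDiff ℝ ∞ v := hρ.contDiff_mollify hψ hut
  have hGs : ∀ k, ContDiff ℝ ∞ (G k) := fun k => hρ.contDiff_mollify hψ (hgt k)
  have hGn : ∀ k, eLpNorm (G k) 2 ≤ ENNReal.ofReal c * eLpNorm (Ω.indicator (g k)) 2 := fun k =>
    hρ.eLpNorm_mollify_le hδ hA hψA (hgt k).1
  -- Chain rule with Dψ = 1 + 4δ DX. The δ-ball about ψ x lies in Ω, so the derivatives of the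
  -- convolution at ψ x are mollified weak derivatives.
  have hgrad : ∀ x ∈ Ω, ∀ i, pderiv i v x = G i x +
      (4 * δ) • (∑ k, (fderiv ℝ X x (EuclideanSpace.single i 1)) k • G k x) := by
    intro x hx i
    have hconv : ContDiff ℝ ∞ (convolution ρ (Ω.indicator u)
        (ContinuousLinearMap.lsmul ℝ ℝ) volume) :=
      hρ.hasCompactSupport.contDiff_convolution_left (n := ⊤) _ hρ.contDiff
        (hut.locallyIntegrable (by norm_num))
    have hψd : HasFDerivAt ψ (ContinuousLinearMap.id ℝ Plane + (4 * δ) • fderiv ℝ X x) x :=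
      (hasFDerivAt_id x).add
        (((hX.differentiable (by simp)) x).hasFDerivAt.const_smul (4 * δ))
    have h1 := ((hconv.differentiable (by simp)) (ψ x)).hasFDerivAt.comp x hψd
    have h2 : ∀ k, _ := fun k => hρ.pderiv_convolution hΩ hu (z := ψ x)
      (hshift δ hδ b0 x hx) k
    have h3 : pderiv i v x = fderiv ℝ (convolution ρ (Ω.indicator u)
        (ContinuousLinearMap.lsmul ℝ ℝ) volume) (ψ x)
        (EuclideanSpace.single i 1 + (4 * δ) • fderiv ℝ X x (EuclideanSpace.single i 1)) := by
      rw [pderiv, show v = convolution ρ (Ω.indicator u)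
        (ContinuousLinearMap.lsmul ℝ ℝ) volume ∘ ψ from rfl, h1.fderiv]
      rfl
    rw [h3, map_add, map_smul, fderiv_apply_eq _ _ (fderiv ℝ X x _), h2, h2, Fin.sum_univ_two]
    congr 1
    exact h2 i
  have hdiff : ∀ i, eLpNorm (pderiv i v - g i) 2 (volume.restrict Ω) ≤
      eLpNorm (G i - Ω.indicator (g i)) 2 +
        ENNReal.ofReal (4 * δ * A₁) * (eLpNorm (G 0) 2 + eLpNorm (G 1) 2) := by
    intro i
    have e1 : eLpNorm (pderiv i v - g i) 2 (volume.restrict Ω) ≤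
        eLpNorm ((fun x => ‖(G i - Ω.indicator (g i)) x‖) +
          (4 * δ * A₁) • ((fun x => ‖G 0 x‖) + fun x => ‖G 1 x‖)) 2 (volume.restrict Ω) := by
      refine eLpNorm_mono_ae_real ((ae_restrict_iff' hΩ).2 (Eventually.of_forall fun x hx => ?_))
      have hk : ∀ k, ‖(fderiv ℝ X x (EuclideanSpace.single i 1)) k‖ ≤ A₁ := by
        intro k
        refine (PiLp.norm_apply_le _ k).trans (((fderiv ℝ X x).le_opNorm _).trans ?_)
        simpa using hA₁ x
      simp only [Pi.sub_apply, Pi.add_apply, Pi.smul_apply, smul_eq_mul]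
      rw [hgrad x hx i, Set.indicator_of_mem hx, add_sub_right_comm]
      refine (norm_add_le _ _).trans (add_le_add le_rfl ?_)
      rw [norm_smul, Real.norm_of_nonneg (by positivity), mul_assoc (4 * δ)]
      refine mul_le_mul_of_nonneg_left ?_ (by positivity)
      rw [Fin.sum_univ_two, mul_add]
      refine (norm_add_le _ _).trans (add_le_add ?_ ?_) <;>
      · rw [norm_smul]
        exact mul_le_mul_of_nonneg_right (hk _) (norm_nonneg _)
    have a0 := (hGs 0).continuous.norm.aestronglyMeasurable (μ := volume)
    have a1 := (hGs 1).continuous.norm.aestronglyMeasurable (μ := volume)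
    have ai := ((hGs i).continuous.aestronglyMeasurable (μ := volume)).sub (hgt i).1
    refine e1.trans ((eLpNorm_mono_measure _ Measure.restrict_le_self).trans ?_)
    refine (eLpNorm_add_le ai.norm ((a0.add a1).const_smul _) (by norm_num)).trans ?_
    rw [eLpNorm_norm, eLpNorm_const_smul, Real.enorm_eq_ofReal (by positivity)]
    refine add_le_add le_rfl (mul_le_mul' le_rfl ?_)
    refine (eLpNorm_add_le a0 a1 (by norm_num)).trans (le_of_eq ?_)
    rw [eLpNorm_norm, eLpNorm_norm]
  have hsmall : ENNReal.ofReal (4 * δ * A₁) * (eLpNorm (G 0) 2 + eLpNorm (G 1) 2) ≤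
      ENNReal.ofReal (κ / 4) := by
    have f0 : eLpNorm (Ω.indicator (g 0)) 2 = ENNReal.ofReal n₀ :=
      (ENNReal.ofReal_toReal (hgt 0).2.ne).symm
    have f1 : eLpNorm (Ω.indicator (g 1)) 2 = ENNReal.ofReal n₁ :=
      (ENNReal.ofReal_toReal (hgt 1).2.ne).symm
    refine (mul_le_mul' le_rfl (add_le_add (hGn 0) (hGn 1))).trans ?_
    rw [f0, f1, ← mul_add, ← ENNReal.ofReal_add hn₀0 hn₁0, ← ENNReal.ofReal_mul hcpos.le,
      ← ENNReal.ofReal_mul (by positivity)]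
    refine ENNReal.ofReal_le_ofReal ?_
    have := (lt_div_iff₀ hPpos).1 b4
    rw [hP] at this
    nlinarith
  have hi2 : ∀ i, eLpNorm (G i - Ω.indicator (g i)) 2 ≤ ENNReal.ofReal (κ / 4) := by
    intro i
    fin_cases i
    · exact hm2 δ hδ b2 ρ hρ ψ hψ hψA
    · exact hm3 δ hδ b3 ρ hρ ψ hψ hψA
  have hgv : ∀ i, eLpNorm (pderiv i v - g i) 2 (volume.restrict Ω) ≤ ENNReal.ofReal (κ / 2) := by
    intro i
    refine (hdiff i).trans ((add_le_add (hi2 i) hsmall).trans (le_of_eq ?_))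
    rw [← ENNReal.ofReal_add (by positivity) (by positivity)]
    congr 1; ring
  have huv : eLpNorm (v - u) 2 (volume.restrict Ω) ≤ ENNReal.ofReal (κ / 2) := by
    have e : eLpNorm (v - u) 2 (volume.restrict Ω) =
        eLpNorm (v - Ω.indicator u) 2 (volume.restrict Ω) :=
      eLpNorm_congr_ae ((ae_restrict_iff' hΩ).2 (Eventually.of_forall fun x hx => by
        rw [Pi.sub_apply, Pi.sub_apply, Set.indicator_of_mem hx]))
    rw [e]
    exact (eLpNorm_mono_measure _ Measure.restrict_le_self).trans (hm1 δ hδ b1 ρ hρ ψ hψ hψA)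
  have hdm : ∀ i, MemLp (pderiv i v - g i) 2 (volume.restrict Ω) := fun i =>
    ⟨(contDiff_pderiv hvs i).continuous.aestronglyMeasurable.sub (hu.memLp_grad i).1,
      (hgv i).trans_lt ENNReal.ofReal_lt_top⟩
  have hdu : MemLp (v - u) 2 (volume.restrict Ω) :=
    ⟨hvs.continuous.aestronglyMeasurable.sub hu.memLp.1, huv.trans_lt ENNReal.ofReal_lt_top⟩
  -- Ω may be unbounded, so the mollification need not have compact support and is truncated.
  obtain ⟨φ, hφ, hφc, h1, h2⟩ := exists_hasCompactSupport_approx hvs (Ω := Ω)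
    (by simpa using hdu.add hu.memLp) (fun i => by simpa using (hdm i).add (hu.memLp_grad i))
    (show 0 < κ / 2 by positivity)
  have hsum : ENNReal.ofReal (κ / 2) + ENNReal.ofReal (κ / 2) = ENNReal.ofReal κ := by
    rw [← ENNReal.ofReal_add (by positivity) (by positivity), add_halves]
  refine ⟨φ, hφ, hφc, ?_, fun i => ?_⟩
  · rw [← sub_add_sub_cancel φ v u, ← hsum]
    exact (eLpNorm_add_le (hφ.sub hvs).continuous.aestronglyMeasurable hdu.1 (by norm_num)).trans
      (add_le_add h1 huv)
  · rw [← sub_add_sub_cancel (pderiv i φ) (pderiv i v) (g i), ← hsum]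
    exact (eLpNorm_add_le ((contDiff_pderiv hφ i).sub
      (contDiff_pderiv hvs i)).continuous.aestronglyMeasurable (hdm i).1 (by norm_num)).trans
      (add_le_add (h2 i) (hgv i))

end SmoothBoundary
end RobinLaplacian
end

/-! ### The theorem -/

theorem theorem5p2 (Ω : Set RobinLaplacian.Plane) (m : ℕ)
    (B : RobinLaplacian.SmoothBoundary Ω m) :
    -- every function in `H¹(Ω)` has a trace, so that `q_h` is defined on `H¹(Ω)`
    (∀ (u : RobinLaplacian.Plane → ℂ) (g : Fin 2 → RobinLaplacian.Plane → ℂ),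
      RobinLaplacian.IsH1 Ω u g → ∃ τ, RobinLaplacian.IsTrace B u g τ) ∧
    -- the lower bound
    ∃ C : ℝ, 0 < C ∧ ∃ h₀ : ℝ, 0 < h₀ ∧ h₀ < 1 ∧
      ∀ h : ℝ, 0 < h → h < h₀ →
        ∀ (u : RobinLaplacian.Plane → ℂ) (g : Fin 2 → RobinLaplacian.Plane → ℂ)
          (τ : RobinLaplacian.Plane → ℂ),
          RobinLaplacian.IsH1 Ω u g → RobinLaplacian.IsTrace B u g τ →
            IntegrableOn (fun x => B.U C h x * ‖u x‖ ^ 2) Ω ∧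
            ∫ x in Ω, B.U C h x * ‖u x‖ ^ 2 ≤ RobinLaplacian.quadForm B h g τ := by
  refine ⟨fun u g hu => B.exists_isTrace_of_approx hu fun δ hδ => B.exists_smooth_approx hu hδ, ?_⟩
  obtain ⟨ε, hε⟩ := B.exists_isTubeRadius
  obtain ⟨K, hK1, hK⟩ := B.exists_curvature_bound
  have hεpos := hε.pos
  have hCpos : 0 < RobinLaplacian.lowerConst K := by
    rw [RobinLaplacian.lowerConst]; positivity
  -- The two conditions on η = h^{1/8}: collars of width 2η inside the tube, and 16Kη ≤ 1.
  set η₀ := min (ε / 2) (1 / (16 * K)) with hη₀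
  have hη₀pos : 0 < η₀ := by positivity
  have hη₀1 : η₀ < 1 := by
    refine (min_le_right _ _).trans_lt ((div_lt_one (by positivity)).2 (by linarith))
  refine ⟨RobinLaplacian.lowerConst K, hCpos, η₀ ^ 8, by positivity,
    pow_lt_one₀ hη₀pos.le hη₀1 (by norm_num), fun h hh hlt u g τ hu hτ => ?_⟩
  obtain ⟨η, hη, rfl⟩ : ∃ η : ℝ, 0 < η ∧ h = η ^ 8 :=
    ⟨h ^ (1 / 8 : ℝ), by positivity, by
      rw [← Real.rpow_natCast, ← Real.rpow_mul hh.le]; norm_num⟩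
  have hηlt : η < η₀ := lt_of_pow_lt_pow_left₀ 8 hη₀pos.le hlt
  have hηε : 2 * η ≤ ε := by linarith [hηlt.trans_le (min_le_left (ε / 2) (1 / (16 * K)))]
  have hηK : 16 * K * η ≤ 1 := by
    have := mul_le_mul_of_nonneg_left (hηlt.le.trans (min_le_right (ε / 2) (1 / (16 * K))))
      (show 0 ≤ 16 * K by positivity)
    rwa [show 16 * K * (1 / (16 * K)) = 1 by field_simp] at this
  exact ⟨hε.integrableOn_U_mul hK hη hηε hCpos.le
    ((memLp_two_iff_integrable_sq_norm hu.memLp.1).1 hu.memLp),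
    hε.lower_bound hK1 hK hη hηε hηK hu hτ⟩
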